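/- **Setting.** A block at height $g$ of a blockchain contains $L$ transactions, $L\ge 2$ a power of two. Its producer builds a coded Merkle tree on them: the bottom layer has the $L$ transactions as data symbols and $L$ coded symbols; the next layer has $L/2$ data symbols, each made of the hashes of four symbols of the layer below (two data, two coded), and $L/2$ coded symbols; and so on up to the root symbol, whose hash is in the block header. Symbol values lie in an abelian group, and in each layer a fixed public family of parity equations (sets of symbols required to sum to $0$) is prescribed; hashes are idealised as collision-free (injective). A *stopping set* of a layer is a set of symbols whose removal makes peeling decoding fail, and $f\in[0,1]$ is such that every stopping set of every layer contains at least a fraction $f$ of the symbols of the layer. The block is *valid* if all its transactions are valid (valid signature, valid Merkle proofs that the inputs are outputs paid to the sender in earlier blocks, sum of inputs equal to sum of outputs, no input spent in an earlier block) and all parity equations hold; the transactions of the earlier blocks are assumed valid. A fixed set of symbols is released to the network, the others are hidden; the block is *available* if the root symbol is released and no layer has a hidden stopping set. There are $N_h$ honest nodes and a fraction $\alpha<1$ of all $N=N_h/(1-\alpha)$ nodes is dishonest. Accounts are divided into $k\ge 1$ sections. Independently and uniformly, each honest node chooses one section and $\lceil L/k\rceil$ bottom-layer symbols. Its desired symbols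 are those on the paths from its chosen symbols to the root and all their siblings; its needed symbols are those occurring in a parity equation together with a desired symbol. It is interested in these and in the transactions whose sender lies in its section. The honest nodes are connected by an independent Erdős–Rényi graph with edge probability $p$. They run CoVer: messages are gossiped if they verify (symbols with a Merkle proof, only between neighbours both interested in the symbol; fraud proofs and coding fraud proofs to everybody); nodes decode their desired symbols layer by layer by peeling, checking hashes and issuing a coding fraud proof on a mismatch; and they validate the transactions of their section, issuing a fraud proof for an invalid one. A node accepts if it obtains all its desired symbols and no valid fraud proof or coding fraud proof, and rejects otherwise. Waiting times suffice for all broadcasts to complete. The adversary (producer and dishonest nodes) sees all random choices and sends arbitrary messages to honest nodes; if a released symbol is of interest to some honest node, it is sent, with a valid Merkle proof, to at least one honest node interested in it; and hidden symbols with valid Merkle proofs are never sent. **Theorem 1.** Let $\lambda>0$, $N_h\ge k(\log L+\lambda)$, and let the number $pN$ of neighbours per node satisfy $$pN\ \ge\ 8\lambda k\cdot\frac1{1-\alpha}\cdot\frac{\log\left(\frac{N_h\,\ell}{8k}\right)}{\ell},\qquad \ell=\min\{\log L,\,4\}.$$ Then the following hold. 1. If the block is valid and available, then all honest nodes accept it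 with probability $\ge 1-e^{-\lambda}-4L\left(\frac{N_h}{8k}\right)^{1-\lambda}-4L\exp\left(-\frac{N_h}{8(4k-1)}\right)$. 2. If the block is unavailable, then all honest nodes reject it with probability $\ge 1-N_h(1-f)^{L/k}$. 3. If the block is invalid but available, then all honest nodes reject it with probability $\ge 1-e^{-\lambda}-4L\left(\frac{N_h}{8k}\right)^{1-\lambda}-4L\exp\left(-\frac{N_h}{8(4k-1)}\right)$. -/

import Mathlib

namespace CoVer

/-! ### The coded Merkle tree

A block has `L = 2 ^ (n + 1)` transactions.  Layer `0` of the tree is the single root symbol; layer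
`ℓ + 1` (for `ℓ = 0, …, n`) has `2 ^ (ℓ + 1)` data symbols and as many coded symbols.  The data
symbols of layer `n + 1`, the bottom layer, are the transactions. -/

/-- Position of a symbol inside layer `ℓ + 1`: `(false, j)` is the `j`-th data symbol and `(true, j)`
the `j`-th coded symbol. -/
abbrev Pos (ℓ : ℕ) : Type := Bool × Fin (2 ^ (ℓ + 1))

/-- The symbols of the tree: `none` is the root symbol, `some ⟨ℓ, b⟩` is symbol `b` of layer
`ℓ + 1`. -/
abbrev Sym (n : ℕ) : Type := Option (Σ ℓ : Fin (n + 1), Pos ℓ)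

/-- The layer of a symbol. -/
def layer {n : ℕ} : Sym n → ℕ
  | none => 0
  | some ⟨ℓ, _⟩ => ℓ + 1

/-- The symbol of the layer above that contains the hash of the given symbol: data symbol `j` of a
layer contains the hashes of the data symbols `2j, 2j+1` and of the coded symbols `2j, 2j+1` of the
layer below.  (Junk value: the root is its own parent.) -/
def parent {n : ℕ} : Sym n → Sym n
  | none => none
  | some ⟨⟨0, _⟩, _⟩ => none
  | some ⟨⟨ℓ + 1, h⟩, (_, j)⟩ =>
      some ⟨⟨ℓ, Nat.lt_of_succ_lt h⟩,
        (false, ⟨j / 2, by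
          have h1 : (j : ℕ) < 2 ^ (ℓ + 1 + 1) := j.2
          have h2 : 2 ^ (ℓ + 1 + 1) = 2 ^ (ℓ + 1) * 2 := pow_succ 2 (ℓ + 1)
          show (j : ℕ) / 2 < 2 ^ (ℓ + 1)
          omega⟩)⟩

/-- Which of the four hashes stored in its parent belongs to a symbol. -/
def slot {n : ℕ} : Sym n → Bool × Fin 2
  | none => (false, 0)
  | some ⟨_, (b, j)⟩ => (b, ⟨j % 2, Nat.mod_lt _ Nat.two_pos⟩)

/-- The symbols of the bottom layer. -/
def bottom (n : ℕ) (b : Pos n) : Sym n := some ⟨Fin.last n, b⟩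

/-- The bottom-layer data symbol holding the `j`-th transaction. -/
def leaf (n : ℕ) (j : Fin (2 ^ (n + 1))) : Sym n := bottom n (false, j)

/-! ### Peeling decoding and stopping sets -/

/-- `Peeled P K a`: symbol `a` is recovered by the peeling decoder for the parity equations `P` (each
given by the set of symbols occurring in it) started from the known symbols `K`. -/
inductive Peeled {S : Type*} (P : Finset (Finset S)) (K : Set S) : S → Prop
  | known {a : S} : a ∈ K → Peeled P K a
  | peel {e : Finset S} {a : S} : e ∈ P → a ∈ e → (∀ b ∈ e, b ≠ a → Peeled P K b) → Peeled P K a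

/-- A stopping set: a set of symbols whose removal prevents peeling decoding from succeeding. -/
def IsStoppingSet {S : Type*} (P : Finset (Finset S)) (T : Finset S) : Prop :=
  ¬ ∀ a, Peeled P {b | b ∉ T} a

/-! ### Transactions, the parameters of the protocol, blocks -/

/-- An input of a transaction: the past transaction output `(txid, idx)`, with a Merkle proof for the
past transaction: the height of its block, its position in that block, its symbol and the path of
symbols from there to the root. -/
structure TxInput (n : ℕ) (F H : Type*) where
  txid : H
  idx : ℕ
  height : ℕ
  pos : Fin (2 ^ (n + 1))
  funding : F
  path : List F

/-- A transaction; an output is a recipient with an amount. -/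
structure Tx (n : ℕ) (F H A Sg : Type*) where
  sender : A
  signature : Sg
  outputs : List (A × ℕ)
  inputs : List (TxInput n F H)

/-- The public parameters.  `F` is the group of symbol values, `H` the type of hashes, `A` that of
account numbers, `Sg` that of signatures.  Injectivity of `hash` is the idealisation that no hash
collision can be found; `pack` and `enc` are serialisation formats. -/
structure Scheme (n k : ℕ) (F H A Sg : Type*) where
  hash : F → H
  hash_injective : Function.Injective hash
  /-- A data symbol above the bottom layer is made of four hashes. -/
  pack : (Bool × Fin 2 → H) → F
  pack_injective : Function.Injective pack
  /-- A data symbol of the bottom layer is a serialised transaction. -/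
  enc : Tx n F H A Sg → F
  enc_injective : Function.Injective enc
  /-- Verification of the signature of a transaction. -/
  sigValid : Tx n F H A Sg → Prop
  /-- The division of the account numbers into `k` sections. -/
  sect : A → Fin k
  /-- The parity equations of the code of layer `ℓ + 1`; an equation is given by the set of symbols
  that it requires to sum to zero. -/
  code : (ℓ : Fin (n + 1)) → Finset (Finset (Pos ℓ))

section
variable {n k : ℕ} {F H A Sg : Type*}

/-- A block: its transactions and the coded Merkle tree that its producer built on them.  The coded
symbols are arbitrary, since a dishonest producer need not respect the parity equations. -/
structure Block (C : Scheme n k F H A Sg) where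
  tx : Fin (2 ^ (n + 1)) → Tx n F H A Sg
  val : Sym n → F
  val_leaf : ∀ j, val (leaf n j) = C.enc (tx j)
  /-- The parent of a symbol is made of four hashes, among them the hash of the symbol. -/
  val_parent : ∀ v, v ≠ none →
    ∃ g : Bool × Fin 2 → H, val (parent v) = C.pack g ∧ g (slot v) = C.hash (val v)

/-- The Merkle root in the header of a block. -/
def Block.root {C : Scheme n k F H A Sg} (B : Block C) : H := C.hash (B.val none)

/-- `HashProof C rt π v h`: the symbols `π`, listed from the parent of `v` up to the root of the tree,
prove that `h` is the hash of symbol `v` committed to by the Merkle root `rt`. -/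
def HashProof (C : Scheme n k F H A Sg) (rt : H) : List F → Sym n → H → Prop
  | [], v, h => v = none ∧ h = rt
  | y :: π, v, h => v ≠ none ∧ (∃ g, y = C.pack g ∧ g (slot v) = h) ∧
      HashProof C rt π (parent v) (C.hash y)

/-- `π` is a valid Merkle proof, for the root `rt`, that symbol `v` has value `x`. -/
def MerkleProof (C : Scheme n k F H A Sg) (rt : H) (v : Sym n) (x : F) (π : List F) : Prop :=
  HashProof C rt π v (C.hash x)

/-! ### Validity.  `chain g` is the block at height `g`. -/

/-- The Merkle proof of an input in a block at height `g` is valid: it links a transaction with the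
given id (the hash of the transaction) to the root of an earlier block; and the referenced output of
that transaction pays `amount` to `sender`. -/
def InputOK {C : Scheme n k F H A Sg} (chain : ℕ → Block C) (g : ℕ) (sender : A)
    (inp : TxInput n F H) (amount : ℕ) : Prop :=
  inp.height < g ∧ C.hash inp.funding = inp.txid ∧
  MerkleProof C (chain inp.height).root (leaf n inp.pos) inp.funding inp.path ∧
  ∃ t : Tx n F H A Sg, C.enc t = inp.funding ∧ t.outputs[inp.idx]? = some (sender, amount)

/-- The checks of a transaction that need only the header chain: the signature is valid, the input
proofs are valid, the sum of the inputs equals the sum of the outputs. -/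
def WellFormed {C : Scheme n k F H A Sg} (chain : ℕ → Block C) (g : ℕ) (t : Tx n F H A Sg) : Prop :=
  C.sigValid t ∧ ∃ amounts : List ℕ, List.Forall₂ (InputOK chain g t.sender) t.inputs amounts ∧
    amounts.sum = (t.outputs.map Prod.snd).sum

/-- The two transactions spend a common transaction output. -/
def Collide (t t' : Tx n F H A Sg) : Prop :=
  ∃ a ∈ t.inputs, ∃ b ∈ t'.inputs, (a.txid, a.idx) = (b.txid, b.idx)

/-- Validity of a transaction in a block at height `g`: the checks above, and its inputs have not been
spent in an earlier block. -/
def TxValid {C : Scheme n k F H A Sg} (chain : ℕ → Block C) (g : ℕ) (t : Tx n F H A Sg) : Prop :=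
  WellFormed chain g t ∧ ∀ g' < g, ∀ j, ¬ Collide t ((chain g').tx j)

/-- No coding fraud: every parity equation of every layer sums to zero. -/
def CodeValid [AddCommGroup F] {C : Scheme n k F H A Sg} (B : Block C) : Prop :=
  ∀ ℓ, ∀ e ∈ C.code ℓ, ∑ b ∈ e, B.val (some ⟨ℓ, b⟩) = 0

/-- Validity of the block at height `g`. -/
def BlockValid [AddCommGroup F] {C : Scheme n k F H A Sg} (chain : ℕ → Block C) (g : ℕ) : Prop :=
  (∀ j, TxValid chain g ((chain g).tx j)) ∧ CodeValid (chain g)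

/-- Availability of a block of which the symbols in `R` have been released: no stopping set is hidden,
i.e. the root symbol is released and in each other layer peeling decoding, started from the released
symbols, recovers the layer. -/
def Available (C : Scheme n k F H A Sg) (R : Set (Sym n)) : Prop :=
  none ∈ R ∧ ∀ ℓ, ∀ b, Peeled (C.code ℓ) {b | some ⟨ℓ, b⟩ ∈ R} b

/-! ### Fraud proofs and messages -/

/-- A fraud proof: the invalid transaction with its position and Merkle proof and, in the case of double
spending, a past transaction with its block height, position and Merkle proof. -/
structure FraudProof (n : ℕ) (F H A Sg : Type*) where
  tx : Tx n F H A Sg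
  pos : Fin (2 ^ (n + 1))
  path : List F
  past : Option (Tx n F H A Sg × ℕ × Fin (2 ^ (n + 1)) × List F)

/-- The verification of a fraud proof against the block at height `g`. -/
def FraudProof.Valid {C : Scheme n k F H A Sg} (chain : ℕ → Block C) (g : ℕ)
    (p : FraudProof n F H A Sg) : Prop :=
  MerkleProof C (chain g).root (leaf n p.pos) (C.enc p.tx) p.path ∧
  (∀ q ∈ p.past, q.2.1 < g ∧
    MerkleProof C (chain q.2.1).root (leaf n q.2.2.1) (C.enc q.1) q.2.2.2) ∧
  (¬ WellFormed chain g p.tx ∨ ∃ q ∈ p.past, Collide p.tx q.1)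

/-- A coding fraud proof: a parity equation `eqn` of layer `ℓ + 1`, one of its symbols `d`, the value
`decoded` obtained for it from the equation, its committed hash with a proof, and the other symbols of
the equation with their Merkle proofs. -/
structure CodingFraudProof (n : ℕ) (F H : Type*) where
  ℓ : Fin (n + 1)
  eqn : Finset (Pos ℓ)
  d : Pos ℓ
  decoded : F
  committed : H
  hashPath : List F
  others : Pos ℓ → F
  paths : Pos ℓ → List F

/-- The verification of a coding fraud proof against the Merkle root `rt`. -/
def CodingFraudProof.Valid [AddCommGroup F] (C : Scheme n k F H A Sg) (rt : H)
    (p : CodingFraudProof n F H) : Prop :=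
  HashProof C rt p.hashPath (some ⟨p.ℓ, p.d⟩) p.committed ∧
  (∀ b ∈ p.eqn.erase p.d, MerkleProof C rt (some ⟨p.ℓ, b⟩) (p.others b) (p.paths b)) ∧
  p.eqn ∈ C.code p.ℓ ∧ p.d ∈ p.eqn ∧
  p.decoded + ∑ b ∈ p.eqn.erase p.d, p.others b = 0 ∧
  C.hash p.decoded ≠ p.committed

/-- Messages: symbols `v` with a value and a Merkle proof, fraud proofs, coding fraud proofs. -/
inductive Msg (n : ℕ) (F H A Sg : Type*)
  | symbol (v : Sym n) (x : F) (π : List F)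
  | fraud (p : FraudProof n F H A Sg)
  | coding (p : CodingFraudProof n F H)

/-- The check that an honest node applies to every message about the block at height `g`. -/
def Msg.Valid [AddCommGroup F] {C : Scheme n k F H A Sg} (chain : ℕ → Block C) (g : ℕ) :
    Msg n F H A Sg → Prop
  | .symbol v x π => MerkleProof C (chain g).root v x π
  | .fraud p => p.Valid chain g
  | .coding p => p.Valid C (chain g).root

/-! ### The choices of the honest nodes -/

/-- The random choices of an honest node: a section to validate, and `c` symbols of the bottom
layer. -/
abbrev Choice (n k c : ℕ) : Type := Fin k × (Fin c → Pos n)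

/-- The desired symbols of a node, i.e. its sampled subtree: the paths of its samples to the root, with
all siblings of the symbols on these paths. -/
def Desired {c : ℕ} (q : Choice n k c) (v : Sym n) : Prop :=
  ∃ t r, layer v = layer (parent^[r] (bottom n (q.2 t))) ∧
    parent v = parent (parent^[r] (bottom n (q.2 t)))

/-- The needed symbols: those in a parity equation that involves a desired symbol. -/
def Needed {c : ℕ} (C : Scheme n k F H A Sg) (q : Choice n k c) (v : Sym n) : Prop :=
  ∃ ℓ, ∃ e ∈ C.code ℓ, ∃ b ∈ e, v = some ⟨ℓ, b⟩ ∧ ∃ d ∈ e, Desired q (some ⟨ℓ, d⟩)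

/-- The symbols a node is interested in: the desired ones, the needed ones, and the transactions whose
sender belongs to the node's section. -/
def Interested {c : ℕ} {C : Scheme n k F H A Sg} (B : Block C) (q : Choice n k c) (v : Sym n) : Prop :=
  Desired q v ∨ Needed C q v ∨ ∃ j, v = leaf n j ∧ C.sect (B.tx j).sender = q.1

/-- The messages a node takes part in gossiping: the symbols it is interested in, and all fraud proofs
and coding fraud proofs. -/
def Wants {c : ℕ} {C : Scheme n k F H A Sg} (B : Block C) (q : Choice n k c) : Msg n F H A Sg → Prop
  | .symbol v _ _ => Interested B q v
  | .fraud _ => True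
  | .coding _ => True

/-! ### The protocol -/

/-- `Holds chain g G q adv i m`: in the run of the protocol on the block at height `g`, honest node `i`
eventually holds the message `m`, having checked or produced it.  `G` is the graph of the connections
between the honest nodes, `q` are their choices, and `adv i m` says that the adversary (the producer of
the block and the dishonest nodes) sends message `m` to node `i`.  The waiting delays of the protocol
are taken to be long enough for all broadcasts to complete. -/
inductive Holds [AddCommGroup F] {C : Scheme n k F H A Sg} (chain : ℕ → Block C) (g : ℕ) {N c : ℕ}
    (G : SimpleGraph (Fin N)) (q : Fin N → Choice n k c) (adv : Fin N → Msg n F H A Sg → Prop) :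
    Fin N → Msg n F H A Sg → Prop
  /-- A message of the adversary is checked. -/
  | inject {i m} : adv i m → m.Valid chain g → Wants (chain g) (q i) m → Holds chain g G q adv i m
  /-- Gossip, along edges between nodes that are both interested in the message. -/
  | gossip {i j m} : Holds chain g G q adv j m → G.Adj j i → Wants (chain g) (q j) m →
      Wants (chain g) (q i) m → Holds chain g G q adv i m
  /-- Collaborative decoding: node `i`, which has decoded its desired symbols in the layers above (with
  values `x'` and Merkle proofs `π'`), solves a parity equation for a desired symbol, and the result
  has the hash stored in the parent symbol. -/
  | peel {i} {ℓ : Fin (n + 1)} {e : Finset (Pos ℓ)} {d : Pos ℓ} {x' : Sym n → F}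
      {π' : Sym n → List F} {others : Pos ℓ → F} {paths : Pos ℓ → List F} {x : F}
      {h : Bool × Fin 2 → H} :
      e ∈ C.code ℓ → d ∈ e → Desired (q i) (some ⟨ℓ, d⟩) →
      (∀ w, Desired (q i) w → layer w ≤ ℓ → Holds chain g G q adv i (.symbol w (x' w) (π' w))) →
      (∀ b ∈ e.erase d, Holds chain g G q adv i (.symbol (some ⟨ℓ, b⟩) (others b) (paths b))) →
      x + ∑ b ∈ e.erase d, others b = 0 →
      x' (parent (some ⟨ℓ, d⟩)) = C.pack h → h (slot (some ⟨ℓ, d⟩)) = C.hash x →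
      Holds chain g G q adv i (.symbol (some ⟨ℓ, d⟩) x
        (x' (parent (some ⟨ℓ, d⟩)) :: π' (parent (some ⟨ℓ, d⟩))))
  /-- The same, but the result does not have the stored hash: a coding fraud proof is produced.  As `d`
  need not be unknown before, this includes the check of the parity equations after decoding. -/
  | codingFraud {i} {ℓ : Fin (n + 1)} {e : Finset (Pos ℓ)} {d : Pos ℓ} {x' : Sym n → F}
      {π' : Sym n → List F} {others : Pos ℓ → F} {paths : Pos ℓ → List F} {x : F}
      {h : Bool × Fin 2 → H} :
      e ∈ C.code ℓ → d ∈ e → Desired (q i) (some ⟨ℓ, d⟩) →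
      (∀ w, Desired (q i) w → layer w ≤ ℓ → Holds chain g G q adv i (.symbol w (x' w) (π' w))) →
      (∀ b ∈ e.erase d, Holds chain g G q adv i (.symbol (some ⟨ℓ, b⟩) (others b) (paths b))) →
      x + ∑ b ∈ e.erase d, others b = 0 →
      x' (parent (some ⟨ℓ, d⟩)) = C.pack h → h (slot (some ⟨ℓ, d⟩)) ≠ C.hash x →
      Holds chain g G q adv i (.coding ⟨ℓ, e, d, x, h (slot (some ⟨ℓ, d⟩)),
        x' (parent (some ⟨ℓ, d⟩)) :: π' (parent (some ⟨ℓ, d⟩)), others, paths⟩)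
  /-- Validation of a transaction of the node's section, checks with the header chain. -/
  | malformed {i j t π} : Holds chain g G q adv i (.symbol (leaf n j) (C.enc t) π) →
      C.sect t.sender = (q i).1 → ¬ WellFormed chain g t →
      Holds chain g G q adv i (.fraud ⟨t, j, π, none⟩)
  /-- Validation of a transaction of the node's section, double spending.  The node stores the past
  transactions of its section, with their Merkle proofs. -/
  | doubleSpend {i j t π g' j' π'} : Holds chain g G q adv i (.symbol (leaf n j) (C.enc t) π) →
      C.sect t.sender = (q i).1 → g' < g → C.sect ((chain g').tx j').sender = (q i).1 →
      MerkleProof C (chain g').root (leaf n j') (C.enc ((chain g').tx j')) π' →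
      Collide t ((chain g').tx j') →
      Holds chain g G q adv i (.fraud ⟨t, j, π, some ((chain g').tx j', g', j', π')⟩)

/-- Node `i` accepts the block: it obtained its whole sampled subtree, and neither a valid fraud proof
nor a valid coding fraud proof.  Otherwise it rejects. -/
def Accepts [AddCommGroup F] {C : Scheme n k F H A Sg} (chain : ℕ → Block C) (g : ℕ) {N c : ℕ}
    (G : SimpleGraph (Fin N)) (q : Fin N → Choice n k c) (adv : Fin N → Msg n F H A Sg → Prop)
    (i : Fin N) : Prop :=
  (∀ v, Desired (q i) v → ∃ x π, Holds chain g G q adv i (.symbol v x π)) ∧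
  (∀ p, ¬ Holds chain g G q adv i (.fraud p)) ∧ (∀ p, ¬ Holds chain g G q adv i (.coding p))

/-- Rejection is the opposite of acceptance. -/
def Rejects [AddCommGroup F] {C : Scheme n k F H A Sg} (chain : ℕ → Block C) (g : ℕ) {N c : ℕ}
    (G : SimpleGraph (Fin N)) (q : Fin N → Choice n k c) (adv : Fin N → Msg n F H A Sg → Prop)
    (i : Fin N) : Prop :=
  ¬ Accepts chain g G q adv i

/-! ### The adversary and the probability space -/

/-- The symbols in `R` are released to the network: if some honest node is interested in one of them,
then at least one interested honest node is sent it, with a valid Merkle proof. -/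
def Releases [AddCommGroup F] {C : Scheme n k F H A Sg} (chain : ℕ → Block C) (g : ℕ) {N c : ℕ}
    (q : Fin N → Choice n k c) (R : Set (Sym n)) (adv : Fin N → Msg n F H A Sg → Prop) : Prop :=
  ∀ v ∈ R, (∃ i, Interested (chain g) (q i) v) →
    ∃ i x π, Interested (chain g) (q i) v ∧ (Msg.symbol v x π).Valid chain g ∧ adv i (.symbol v x π)

/-- The symbols outside `R` are hidden: the adversary sends none of them, with a valid Merkle proof, to
an honest node. -/
def Hides [AddCommGroup F] {C : Scheme n k F H A Sg} (chain : ℕ → Block C) (g : ℕ) {N : ℕ}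
    (R : Set (Sym n)) (adv : Fin N → Msg n F H A Sg → Prop) : Prop :=
  ∀ i v x π, adv i (.symbol v x π) → (Msg.symbol v x π).Valid chain g → v ∈ R

end

/-- The probability space: the choices of the `N` honest nodes are independent and uniformly
distributed, and independent of these, the graph of the connections between the honest nodes is an
Erdős–Rényi random graph with connection probability `p`. -/
noncomputable def law (n k c N : ℕ) (p : unitInterval) :
    MeasureTheory.Measure ((Fin N → Choice n k c) × SimpleGraph (Fin N)) :=
  (ProbabilityTheory.uniformOn Set.univ).prod (SimpleGraph.binomialRandom (Fin N) p)

/-- The number of samples of each honest node, `L / k` (rounded up) for `L = 2 ^ (n + 1)`. -/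
noncomputable def numSamples (n k : ℕ) : ℕ := ⌈(2 ^ (n + 1) : ℝ) / k⌉₊

end CoVer

/-!
The probability that something goes wrong is bounded by the probability that the random choices and the
random graph do not *cover* the block (`CoVer.Covered`): the nodes interested in each symbol must form a
connected graph, and each symbol must be desired by some node.  Once they do, everything is
deterministic.

* Every message held by an honest node is valid (`Holds.valid`), and the Merkle root determines all
  symbols (`Block.hash_eq_of_hashProof`), so there are no fraud proofs against a valid block.
* If the block is available, all nodes obtain the symbols they are interested in, unless a coding fraud
  proof appears (`Covered.obtains`): along each step of the peeling decoder of a layer, a node that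
  desires the missing symbol needs the others, decodes it, and gossip carries it to all nodes interested
  in it.  The root symbol interests everybody, so fraud proofs reach everybody.  In an invalid block, the
  violated equation is checked by a node that desires one of its symbols, and the invalid transaction by
  a node of the section of its sender; a past transaction with a common input has the same sender
  (`Collide.sender_eq`), hence is stored by that node.

If the claimed failure bound is at least one there is nothing to prove.  Otherwise `lam > 1` and
`A = N / (2 k)` is at least `24` (`nontrivial_regime`).  A symbol is then desired by at least `3 A / 2`
nodes up to probability `exp (-N / (8 (4 k - 1)))`, by Chernoff's bound
(`uniformOn_real_card_desired_lt_le`).  As `log x / x` decreases, the hypothesis on `p` gives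
`p A ≥ lam log A`, so the random graph on these nodes is disconnected with probability at most
`A ^ (1 - lam) ≤ (N / (8 k)) ^ (1 - lam)`, by the union bound over cuts (`sum_cut_le_rpow`).  There are at
most `4 L` symbols.  The remaining term `exp (-lam)` is a coupon collector bound for the leaves, together
with the probability that the section of the invalid transaction has no node.

If the block is unavailable, the symbols of some layer that cannot be peeled form a stopping set.  The
siblings in that layer of the ancestor of a uniform sample meet it with probability at least `f`
(`exists_card_mul_le`), and a node that desires one of its symbols never obtains it (`Holds.peeled`).
-/

/-! ### Random graphs without sparse cuts -/

namespace CoVer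

/-- `Linked G W`: no nonempty proper subset of `W` is closed under adjacency inside `W`.  This is
connectedness of the subgraph of `G` induced on `W`, without reference to paths. -/
def Linked {V : Type*} (G : SimpleGraph V) (W : Set V) : Prop :=
  ∀ S ⊆ W, S.Nonempty → (∀ i ∈ S, ∀ j ∈ W, G.Adj i j → j ∈ S) → S = W

open MeasureTheory ProbabilityTheory in
lemma binomialRandom_forall_notMem_edgeSet {V : Type*} [Fintype V] (p : unitInterval)
    (E : Finset (Sym2 V)) (hE : ∀ e ∈ E, ¬ e.IsDiag) :
    (SimpleGraph.binomialRandom V p).real {G | ∀ e ∈ E, e ∉ G.edgeSet} =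
      (1 - (p : ℝ)) ^ E.card := by
  have hset : (fun s : Set (Sym2 V) ↦ SimpleGraph.fromEdgeSet s) ⁻¹'
      {G | ∀ e ∈ E, e ∉ G.edgeSet} = {s | ∀ e ∈ E, e ∉ s} := by
    ext s
    simp only [Set.mem_preimage, Set.mem_ofPred_eq, SimpleGraph.edgeSet_fromEdgeSet]
    refine forall₂_congr fun e he => ?_
    have := hE e he
    simp [this]
  have hmeas : Measurable (SimpleGraph.fromEdgeSet : Set (Sym2 V) → SimpleGraph V) := by fun_prop
  have hms : MeasurableSet {G : SimpleGraph V | ∀ e ∈ E, e ∉ G.edgeSet} :=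
    SimpleGraph.measurableEmbedding_edgeSet.measurable
      (t := {s : Set (Sym2 V) | ∀ e ∈ E, e ∉ s}) (Set.toFinite _).measurableSet
  have hpi : (fun p : Sym2 V → Prop ↦ {i | p i}) ⁻¹' {s : Set (Sym2 V) | ∀ e ∈ E, e ∉ s} =
      Set.pi (E : Set (Sym2 V)) (fun _ => {False}) := by
    ext s; simp [Set.pi]
  rw [measureReal_def, SimpleGraph.binomialRandom_eq_map, Measure.map_apply hmeas hms, hset,
    setBernoulli_apply', hpi, Measure.infinitePi_pi _ (by measurability)]
  have : ∀ e ∈ E, ((unitInterval.toNNReal p • Measure.dirac (e ∈ (Sym2.diagSet : Set (Sym2 V))ᶜ) +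
      unitInterval.toNNReal (unitInterval.symm p) • Measure.dirac False : Measure Prop) {False}) =
      (unitInterval.toNNReal (unitInterval.symm p) : ENNReal) := by
    intro e he
    have := hE e he
    simp [this]
  rw [Finset.prod_congr rfl this]
  simp

open MeasureTheory in
/-- Union bound over the smaller side `S` of a cut of `W` without crossing edges. -/
lemma binomialRandom_not_linked_le {N : ℕ} (p : unitInterval) (W : Finset (Fin N)) :
    (SimpleGraph.binomialRandom (Fin N) p).real {G | ¬ Linked G (W : Set (Fin N))} ≤
      ∑ S ∈ W.powerset with S.Nonempty ∧ 2 * S.card ≤ W.card,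
        (1 - (p : ℝ)) ^ (S.card * (W.card - S.card)) := by
  classical
  set cut : Finset (Fin N) → Set (SimpleGraph (Fin N)) :=
    fun S => {G | ∀ e ∈ (S ×ˢ (W \ S)).image (fun x => s(x.1, x.2)), e ∉ G.edgeSet} with hcut
  have mem_cut : ∀ S G, G ∈ cut S ↔ ∀ i ∈ S, ∀ j ∈ W, j ∉ S → ¬ G.Adj i j := by
    intro S G
    simp only [hcut, Set.mem_ofPred_eq, Finset.mem_image, Finset.mem_product, Finset.mem_sdiff,
      Prod.exists]
    constructor
    · intro h i hi j hj hjS hadj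
      exact h _ ⟨i, j, ⟨hi, hj, hjS⟩, rfl⟩ hadj
    · rintro h _ ⟨i, j, ⟨hi, hj, hjS⟩, rfl⟩ hadj
      exact h i hi j hj hjS hadj
  have hsub : {G : SimpleGraph (Fin N) | ¬ Linked G (W : Set (Fin N))} ⊆
      ⋃ S ∈ W.powerset.filter (fun S => S.Nonempty ∧ 2 * S.card ≤ W.card), cut S := by
    intro G hG
    simp only [Set.mem_ofPred_eq, Linked, not_forall] at hG
    obtain ⟨S, hSW, hS, hcl, hne⟩ := hG
    have hfin : ∃ S' : Finset (Fin N), (S' : Set (Fin N)) = S := ⟨S.toFinite.toFinset, by simp⟩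
    obtain ⟨S, rfl⟩ := hfin
    have hSW' : S ⊆ W := by exact_mod_cast hSW
    have hne' : S ≠ W := by exact_mod_cast hne
    simp only [Set.mem_iUnion, Finset.mem_filter, Finset.mem_powerset, exists_prop]
    by_cases hcard : 2 * S.card ≤ W.card
    · refine ⟨S, ⟨hSW', by exact_mod_cast hS, hcard⟩, (mem_cut _ _).2 ?_⟩
      intro i hi j hj hjS hadj
      exact hjS (by simpa using hcl i (by simpa using hi) j (by simpa using hj) hadj)
    · refine ⟨W \ S, ⟨Finset.sdiff_subset, ?_, ?_⟩, (mem_cut _ _).2 ?_⟩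
      · rw [Finset.sdiff_nonempty]
        exact fun h => hne' (Finset.Subset.antisymm hSW' h)
      · rw [Finset.card_sdiff_of_subset hSW']; omega
      · intro i hi j hj hjS hadj
        rw [Finset.mem_sdiff] at hi hjS
        have hjS' : j ∈ S := by by_contra h; exact hjS ⟨hj, h⟩
        exact hi.2 (by simpa using hcl j (by simpa using hjS') i (by simpa using hi.1) hadj.symm)
  refine (measureReal_mono hsub (measure_ne_top _ _)).trans
    ((measureReal_biUnion_finset_le _ _).trans (Finset.sum_le_sum fun S hS => ?_))
  simp only [Finset.mem_filter, Finset.mem_powerset] at hS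
  rw [hcut, binomialRandom_forall_notMem_edgeSet]
  · rw [Finset.card_image_of_injOn, Finset.card_product, Finset.card_sdiff_of_subset hS.1]
    rintro ⟨a, b⟩ hab ⟨a', b'⟩ hab' heq
    simp only [Finset.coe_product, Set.mem_prod, Finset.mem_coe, Finset.mem_sdiff] at hab hab'
    simp only [Sym2.eq_iff] at heq
    rcases heq with ⟨rfl, rfl⟩ | ⟨rfl, rfl⟩
    · rfl
    · exact absurd hab.1 hab'.2.2
  · intro e he
    simp only [Finset.mem_image, Finset.mem_product, Finset.mem_sdiff, Prod.exists] at he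
    obtain ⟨i, j, ⟨hi, -, hj⟩, rfl⟩ := he
    simp only [Sym2.mk_isDiag_iff]
    rintro rfl
    exact hj hi

end CoVer

/-! ### The connectivity threshold -/

namespace CoVer

/-- A subset of size at most a sixth of `W` contributes at most `exp (-5pm/6)` to the power of its
size; each of the at most `2 ^ m` other ones at most `exp (-5pm²/36)`.  The fraction of a sixth is small
enough for `m exp (-5pm/6)` to be at most of the order of the expected number of isolated nodes among
`2m/3` nodes, and large enough for `2 ^ m` to be harmless. -/
lemma sum_cut_le {V : Type*} (W : Finset V) {p : ℝ} (hp0 : 0 ≤ p) (hp1 : p ≤ 1) :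
    ∑ S ∈ W.powerset with S.Nonempty ∧ 2 * S.card ≤ W.card,
        (1 - p) ^ (S.card * (W.card - S.card)) ≤
      Real.exp (W.card * Real.exp (-(5 / 6 * (p * W.card)))) - 1 +
        (2 * Real.exp (-(5 / 36 * (p * W.card)))) ^ W.card := by
  classical
  set m := W.card with hm
  set z := Real.exp (-(5 / 6 * (p * m))) with hz
  set h := Real.exp (-(5 / 36 * (p * m))) ^ m with hh
  have hterm : ∀ S ∈ W.powerset.filter (fun S => S.Nonempty ∧ 2 * S.card ≤ m),
      (1 - p) ^ (S.card * (m - S.card)) ≤ z ^ S.card + h := by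
    intro S hS
    simp only [Finset.mem_filter, Finset.mem_powerset] at hS
    obtain ⟨hSW, -, h2⟩ := hS
    have hle : S.card ≤ m := by omega
    have h1 : (1 - p) ^ (S.card * (m - S.card)) ≤
        Real.exp (-(p * (S.card * (m - S.card)))) := by
      calc (1 - p) ^ (S.card * (m - S.card)) ≤ Real.exp (-p) ^ (S.card * (m - S.card)) :=
            pow_le_pow_left₀ (by linarith) (by linarith [Real.add_one_le_exp (-p)]) _
        _ = _ := by rw [← Real.exp_nat_mul]; push_cast [hle]; ring_nf
    have hs0 : (0 : ℝ) ≤ S.card := by positivity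
    have h2' : 2 * (S.card : ℝ) ≤ m := by exact_mod_cast h2
    rcases le_total (6 * S.card) m with h6 | h6
    · have h6' : 6 * (S.card : ℝ) ≤ m := by exact_mod_cast h6
      refine h1.trans (le_trans ?_ (le_add_of_nonneg_right (by positivity)))
      rw [hz, ← Real.exp_nat_mul]
      apply Real.exp_le_exp.2
      have := mul_nonneg (mul_nonneg hp0 hs0) (sub_nonneg.2 h6')
      nlinarith
    · have h6' : (m : ℝ) ≤ 6 * S.card := by exact_mod_cast h6
      refine h1.trans (le_trans ?_ (le_add_of_nonneg_left (by positivity)))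
      rw [hh, ← Real.exp_nat_mul]
      apply Real.exp_le_exp.2
      have : 0 ≤ ((S.card : ℝ) - m / 6) * (5 * m / 6 - S.card) :=
        mul_nonneg (by linarith) (by linarith)
      nlinarith [mul_nonneg hp0 this]
  have hsum : ∑ S ∈ W.powerset with S.Nonempty ∧ 2 * S.card ≤ m, z ^ S.card ≤ (1 + z) ^ m - 1 := by
    have hall : ∑ S ∈ W.powerset, z ^ S.card = (1 + z) ^ m := by
      have := Finset.sum_pow_mul_eq_add_pow z 1 W
      simpa [add_comm] using this
    rw [← hall, ← Finset.add_sum_erase _ _ (Finset.empty_mem_powerset W)]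
    simp only [Finset.card_empty, pow_zero, add_sub_cancel_left]
    refine Finset.sum_le_sum_of_subset_of_nonneg (fun S hS => ?_) (fun _ _ _ => by positivity)
    simp only [Finset.mem_filter, Finset.mem_erase] at hS ⊢
    exact ⟨hS.2.1.ne_empty, hS.1⟩
  calc _ ≤ ∑ S ∈ W.powerset with S.Nonempty ∧ 2 * S.card ≤ m, (z ^ S.card + h) :=
        Finset.sum_le_sum hterm
    _ ≤ ((1 + z) ^ m - 1) + 2 ^ m * h := by
        rw [Finset.sum_add_distrib, Finset.sum_const, nsmul_eq_mul]
        refine add_le_add hsum (mul_le_mul_of_nonneg_right ?_ (by positivity))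
        calc ((W.powerset.filter _).card : ℝ) ≤ W.powerset.card := by
              exact_mod_cast Finset.card_filter_le _ _
          _ = 2 ^ m := by rw [Finset.card_powerset]; push_cast; rfl
    _ ≤ _ := by
        rw [mul_pow]
        refine add_le_add (sub_le_sub_right ?_ _) le_rfl
        rw [Real.exp_nat_mul]
        exact pow_le_pow_left₀ (by positivity) (by linarith [Real.add_one_le_exp z]) _

/-- The estimate above the connectivity threshold: if `p A ≥ lam log A` and `W` has at least `3 A / 2` elements, then the
failure probability is at most `A ^ (1 - lam)`. -/
lemma sum_cut_le_rpow {V : Type*} (W : Finset V) {p A lam : ℝ} (hp1 : p ≤ 1) (hA : 24 ≤ A)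
    (hw : A ^ (1 - lam) ≤ 1 / 8) (hp : lam * Real.log A ≤ p * A)
    (hW : 3 / 2 * A ≤ W.card) :
    ∑ S ∈ W.powerset with S.Nonempty ∧ 2 * S.card ≤ W.card,
        (1 - p) ^ (S.card * (W.card - S.card)) ≤ A ^ (1 - lam) := by
  have hA0 : 0 < A := by linarith
  set w := A ^ (1 - lam) with hwdef
  set v := A ^ (-lam) with hv
  have hv0 : 0 < v := Real.rpow_pos_of_pos hA0 _
  have hwv : w = A * v := by
    rw [hwdef, sub_eq_add_neg, Real.rpow_add hA0, Real.rpow_one]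
  have hv192 : v ≤ 1 / 192 := by nlinarith
  have hy : Real.exp (-(p * A)) ≤ v := by
    rw [hv, Real.rpow_def_of_pos hA0]
    exact Real.exp_le_exp.2 (by linarith)
  set y := p * A with hydef
  -- `exp y ≥ 192 > exp (9 / 2)`
  have hy45 : 9 / 2 ≤ y := by
    by_contra hlt
    push Not at hlt
    have h1 : Real.exp (-(9 / 2)) ≤ 1 / 192 :=
      (Real.exp_le_exp.2 (by linarith)).trans (hy.trans hv192)
    have h2 : Real.exp (9 / 2) ≤ 3 ^ (9 / 2 : ℝ) := by
      rw [← Real.exp_one_rpow]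
      exact Real.rpow_le_rpow (by positivity) (by linarith [Real.exp_one_lt_d9]) (by norm_num)
    have h3 : (3 : ℝ) ^ (9 / 2 : ℝ) < 192 := by
      have h4 : ((3 : ℝ) ^ (9 / 2 : ℝ)) ^ 2 = 3 ^ 9 := by
        rw [← Real.rpow_natCast, ← Real.rpow_mul (by norm_num)]; norm_num
      nlinarith [Real.rpow_pos_of_pos (show (0 : ℝ) < 3 by norm_num) (9 / 2)]
    rw [Real.exp_neg] at h1
    have h5 := Real.exp_pos (9 / 2)
    rw [inv_le_comm₀ h5 (by norm_num)] at h1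
    norm_num at h1
    linarith
  have hp0 : 0 < p := by
    by_contra h
    push Not at h
    nlinarith
  refine (sum_cut_le W hp0.le hp1).trans ?_
  set m : ℝ := (W.card : ℝ) with hm
  have hm0 : 0 < m := by linarith
  have hpm : 3 / 2 * y ≤ p * m := by rw [hydef]; nlinarith
  -- The small sets: `exp (-5pm/6) ≤ exp (-pA) exp (-pm/6)` and `x exp (-x) ≤ exp (-1)`.
  have hu : m * Real.exp (-(5 / 6 * (p * m))) ≤ w / 2 := by
    have h1 : Real.exp (-(5 / 6 * (p * m))) ≤ v * Real.exp (-(p * m / 6)) := by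
      calc Real.exp (-(5 / 6 * (p * m))) ≤ Real.exp (-y + -(p * m / 6)) :=
            Real.exp_le_exp.2 (by linarith)
        _ ≤ _ := by rw [Real.exp_add]; gcongr
    have h2 : p * m / 6 * Real.exp (-(p * m / 6)) ≤ Real.exp (-1) := by
      have := Real.add_one_le_exp (p * m / 6 - 1)
      calc p * m / 6 * Real.exp (-(p * m / 6))
          ≤ Real.exp (p * m / 6 - 1) * Real.exp (-(p * m / 6)) := by gcongr; linarith
        _ = _ := by rw [← Real.exp_add]; ring_nf
    have h3 : Real.exp (-1) ≤ 3 / 8 := by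
      rw [Real.exp_neg, inv_le_comm₀ (Real.exp_pos 1) (by norm_num)]
      linarith [Real.exp_one_gt_d9]
    have h4 : m * Real.exp (-(p * m / 6)) ≤ A / 2 := by
      have e1 : y * (m * Real.exp (-(p * m / 6))) =
          6 * A * (p * m / 6 * Real.exp (-(p * m / 6))) := by rw [hydef]; ring
      have e2 : 6 * A * (p * m / 6 * Real.exp (-(p * m / 6))) ≤ 6 * A * (3 / 8) := by
        gcongr; exact h2.trans h3
      have e3 : 9 / 2 * (m * Real.exp (-(p * m / 6))) ≤ y * (m * Real.exp (-(p * m / 6))) := by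
        gcongr
      linarith
    calc m * Real.exp (-(5 / 6 * (p * m))) ≤ m * (v * Real.exp (-(p * m / 6))) := by gcongr
      _ = v * (m * Real.exp (-(p * m / 6))) := by ring
      _ ≤ v * (A / 2) := by gcongr
      _ = w / 2 := by rw [hwv]; ring
  have hw0 : 0 < w := by rw [hwv]; positivity
  have hexp : Real.exp (m * Real.exp (-(5 / 6 * (p * m)))) - 1 ≤ 3 / 4 * w := by
    have h1 : Real.exp (w / 2) ≤ 1 / (1 - w / 2) := Real.exp_bound_div_one_sub_of_interval (by linarith) (by linarith)
    have h2 : 1 / (1 - w / 2) ≤ 1 + 3 / 4 * w := by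
      rw [div_le_iff₀ (by linarith)]; nlinarith
    linarith [Real.exp_le_exp.2 hu]
  -- The large sets: already the 24th power of the base is small.
  have hbase : 2 * Real.exp (-(5 / 36 * (p * m))) ≤ 2 * Real.exp (-(5 / 24 * y)) :=
    mul_le_mul_of_nonneg_left (Real.exp_le_exp.2 (by linarith)) (by norm_num)
  have hlarge : (2 * Real.exp (-(5 / 36 * (p * m)))) ^ W.card ≤ w / 4 := by
    have hle1 : 2 * Real.exp (-(5 / 24 * y)) ≤ 1 := by
      have h1 : Real.exp (-(5 / 24 * y)) ≤ Real.exp (-(15 / 16)) :=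
        Real.exp_le_exp.2 (by linarith)
      have h2 : Real.exp (-(15 / 16)) ≤ 1 / 2 := by
        have h3 : (2 : ℝ) ≤ Real.exp (15 / 16) := by
          have h4 := Real.quadratic_le_exp_of_nonneg (show (0 : ℝ) ≤ 15 / 16 by norm_num)
          norm_num at h4 ⊢
          linarith
        rw [Real.exp_neg, one_div]
        exact inv_anti₀ (by norm_num) h3
      linarith
    have h24 : 24 ≤ W.card := by
      have : (24 : ℝ) ≤ W.card := by linarith
      exact_mod_cast this
    calc (2 * Real.exp (-(5 / 36 * (p * m)))) ^ W.card
        ≤ (2 * Real.exp (-(5 / 24 * y))) ^ W.card := by gcongr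
      _ ≤ (2 * Real.exp (-(5 / 24 * y))) ^ 24 :=
          pow_le_pow_of_le_one (by positivity) hle1 h24
      _ = 2 ^ 24 * Real.exp (-y) ^ 5 := by
          rw [mul_pow, ← Real.exp_nat_mul, ← Real.exp_nat_mul]; congr 2; push_cast; ring
      _ ≤ 2 ^ 24 * v ^ 5 := by gcongr
      _ = 2 ^ 24 * v ^ 4 * v := by ring
      _ ≤ 2 ^ 24 * (1 / 192) ^ 4 * v := by gcongr
      _ ≤ w / 4 := by rw [hwv]; norm_num; nlinarith
  linarith

end CoVer

/-! ### Uniform independent choices -/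

namespace CoVer

open MeasureTheory ProbabilityTheory

lemma uniformOn_univ_real {Ω : Type*} [Fintype Ω] [MeasurableSpace Ω] [DiscreteMeasurableSpace Ω]
    (s : Finset Ω) : (uniformOn (Set.univ : Set Ω)).real s = s.card / Fintype.card Ω := by
  rw [measureReal_def, uniformOn_univ, Measure.count_apply_finset]
  simp

section
variable {Q : Type*} [Fintype Q] [MeasurableSpace Q] [DiscreteMeasurableSpace Q] (N : ℕ)

/-- The choices of different nodes are independent. -/
lemma uniformOn_real_forall_mem (D : Fin N → Finset Q) :
    (uniformOn (Set.univ : Set (Fin N → Q))).real {q | ∀ i, q i ∈ D i} =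
      ∏ i, ((D i).card / Fintype.card Q : ℝ) := by
  classical
  have h : {q : Fin N → Q | ∀ i, q i ∈ D i} = (Fintype.piFinset D : Set _) := by
    ext q; simp
  rw [h, uniformOn_univ_real]
  simp [Finset.prod_div_distrib]

lemma uniformOn_real_eval_mem [Nonempty Q] (i : Fin N) (D : Finset Q) :
    (uniformOn (Set.univ : Set (Fin N → Q))).real {q | q i ∈ D} = D.card / Fintype.card Q := by
  classical
  have h : {q : Fin N → Q | q i ∈ D} = {q | ∀ i', q i' ∈ if i' = i then D else Finset.univ} := by
    ext q
    refine ⟨fun hq i' => ?_, fun hq => by simpa using hq i⟩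
    split_ifs with hi
    · rw [hi]; exact hq
    · exact Finset.mem_univ _
  have hQ : (Fintype.card Q : ℝ) ≠ 0 := by exact_mod_cast Fintype.card_ne_zero
  rw [h, uniformOn_real_forall_mem, Finset.prod_eq_single i]
  · simp
  · intro i' _ hi'
    simp [hi', hQ]
  · simp

/-- Chernoff's bound for the lower tail, with the moment generating function at `-log 2`. -/
lemma uniformOn_real_card_lt_le [Nonempty Q] (D : Q → Prop) [DecidablePred D] (a : ℝ) :
    (uniformOn (Set.univ : Set (Fin N → Q))).real
        {q | ((Finset.univ.filter fun i => D (q i)).card : ℝ) < a} ≤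
      2 ^ a * (1 - ((Finset.univ.filter D).card / Fintype.card Q : ℝ) / 2) ^ N := by
  classical
  set Bad : Finset (Fin N → Q) :=
    Finset.univ.filter fun q => ((Finset.univ.filter fun i => D (q i)).card : ℝ) < a with hBad
  have hset : {q : Fin N → Q | ((Finset.univ.filter fun i => D (q i)).card : ℝ) < a} =
      (Bad : Set (Fin N → Q)) := by ext q; simp [hBad]
  have hQ : (0 : ℝ) < Fintype.card Q := by exact_mod_cast Fintype.card_pos
  rw [hset, uniformOn_univ_real]
  have hone : ∀ q : Fin N → Q, (1 / 2 : ℝ) ^ (Finset.univ.filter fun i => D (q i)).card =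
      ∏ i, if D (q i) then (1 / 2 : ℝ) else 1 := by
    intro q
    rw [Finset.prod_ite]; simp
  have hmgf : ∑ q : Fin N → Q, (1 / 2 : ℝ) ^ (Finset.univ.filter fun i => D (q i)).card =
      (Fintype.card Q - (Finset.univ.filter D).card / 2 : ℝ) ^ N := by
    simp_rw [hone]
    rw [← Fintype.piFinset_univ, ← Finset.prod_univ_sum (fun _ => Finset.univ)
      (fun _ x => if D x then (1 / 2 : ℝ) else 1)]
    rw [Finset.prod_const, Finset.card_univ, Fintype.card_fin]
    congr 1
    have h1 : ∀ x, (if D x then (1 / 2 : ℝ) else 1) = 1 - (if D x then (1 / 2 : ℝ) else 0) := by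
      intro x; split_ifs <;> norm_num
    simp_rw [h1]
    rw [Finset.sum_sub_distrib, ← Finset.sum_filter]
    simp
    ring
  have hmarkov : (Bad.card : ℝ) ≤
      2 ^ a * (Fintype.card Q - (Finset.univ.filter D).card / 2 : ℝ) ^ N := by
    rw [← hmgf, Finset.mul_sum]
    calc (Bad.card : ℝ) = ∑ q ∈ Bad, 1 := by simp
      _ ≤ ∑ q ∈ Bad, (2 : ℝ) ^ a * (1 / 2 : ℝ) ^ (Finset.univ.filter fun i => D (q i)).card := by
          refine Finset.sum_le_sum fun q hq => ?_
          have hlt := (Finset.mem_filter.1 hq).2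
          rw [one_div, inv_pow, ← Real.rpow_natCast, ← Real.rpow_neg (by norm_num),
            ← Real.rpow_add (by norm_num)]
          exact Real.one_le_rpow (by norm_num) (by linarith)
      _ ≤ _ := Finset.sum_le_sum_of_subset_of_nonneg (Finset.subset_univ _)
          (fun _ _ _ => by positivity)
  rw [Fintype.card_fun, Fintype.card_fin, div_le_iff₀ (by positivity)]
  refine hmarkov.trans (le_of_eq ?_)
  push_cast
  rw [mul_assoc, ← mul_pow]
  congr 2
  field_simp

end

/-- The probability that none of the `c` samples of a node lies in `B`. -/
lemma card_choice_forall_notMem {n k c : ℕ} (hk : 1 ≤ k) (B : Finset (Pos n)) :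
    ((Finset.univ.filter fun q : Choice n k c => ∀ t, q.2 t ∉ B).card : ℝ) /
        Fintype.card (Choice n k c) =
      (1 - B.card / Fintype.card (Pos n)) ^ c := by
  classical
  have h : (Finset.univ.filter fun q : Choice n k c => ∀ t, q.2 t ∉ B) =
      Finset.univ ×ˢ Fintype.piFinset (fun _ : Fin c => Bᶜ) := by
    ext q; simp
  have hP : (0 : ℝ) < Fintype.card (Pos n) := by exact_mod_cast Fintype.card_pos
  have hk0 : (0 : ℝ) < k := by exact_mod_cast hk
  have hc : Fintype.card (Choice n k c) = k * Fintype.card (Pos n) ^ c := by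
    rw [Fintype.card_prod, Fintype.card_fin, Fintype.card_fun, Fintype.card_fin]
  rw [h, hc, Finset.card_product, Fintype.card_piFinset, Finset.prod_const, Finset.card_compl,
    Finset.card_univ, Finset.card_univ, Fintype.card_fin, Fintype.card_fin, Nat.cast_mul,
    Nat.cast_mul, mul_div_mul_left _ _ hk0.ne', Nat.cast_pow, Nat.cast_pow, ← div_pow,
    Nat.cast_sub (Finset.card_le_univ B), sub_div, div_self hP.ne']

lemma card_choice_fst_ne {n k c : ℕ} (hk : 1 ≤ k) (s : Fin k) :
    ((Finset.univ.filter fun q : Choice n k c => q.1 ≠ s).card : ℝ) /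
        Fintype.card (Choice n k c) = 1 - 1 / k := by
  classical
  have h : (Finset.univ.filter fun q : Choice n k c => q.1 ≠ s) =
      ({s}ᶜ : Finset (Fin k)) ×ˢ Finset.univ := by
    ext q; simp
  have hP : (0 : ℝ) < Fintype.card (Fin c → Pos n) := by exact_mod_cast Fintype.card_pos
  have hk0 : (0 : ℝ) < k := by exact_mod_cast hk
  rw [h, Finset.card_product, Fintype.card_prod, Finset.card_univ, Nat.cast_mul, Nat.cast_mul,
    mul_div_mul_right _ _ hP.ne', Finset.card_compl, Fintype.card_fin, Finset.card_singleton,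
    Nat.cast_sub hk, sub_div, div_self hk0.ne', Nat.cast_one]

instance instIsProbabilityMeasureUniformOn {n k c N : ℕ} [NeZero k] :
    IsProbabilityMeasure (uniformOn (Set.univ : Set (Fin N → Choice n k c))) :=
  isProbabilityMeasure_uniformOn Set.finite_univ Set.univ_nonempty

/-- Conditioning on the choices of the nodes.  As there are finitely many of them, no measurability of the
event `E` is needed. -/
lemma law_real_le {n k c N : ℕ} [NeZero k] (p : unitInterval)
    (E : Set ((Fin N → Choice n k c) × SimpleGraph (Fin N)))
    (Bad : Set (Fin N → Choice n k c)) {b : ℝ} (hb : 0 ≤ b)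
    (h : ∀ q ∉ Bad, (SimpleGraph.binomialRandom (Fin N) p).real {G | (q, G) ∈ E} ≤ b) :
    (law n k c N p).real E ≤
      (uniformOn (Set.univ : Set (Fin N → Choice n k c))).real Bad + b := by
  classical
  set μ := uniformOn (Set.univ : Set (Fin N → Choice n k c)) with hμ
  set ν := SimpleGraph.binomialRandom (Fin N) p
  have hlaw : law n k c N p = μ.prod ν := rfl
  rw [hlaw]
  have hsub : E ⊆ Bad ×ˢ Set.univ ∪ ⋃ q ∈ (Finset.univ.filter fun q => q ∉ Bad),
      ({q} : Set (Fin N → Choice n k c)) ×ˢ {G | (q, G) ∈ E} := by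
    rintro ⟨q, G⟩ hqG
    by_cases hq : q ∈ Bad
    · left; simp [hq]
    · right; simp [hq, hqG]
  refine (measureReal_mono hsub (measure_ne_top _ _)).trans ((measureReal_union_le _ _).trans ?_)
  refine add_le_add (by simp [measureReal_prod_prod]) ?_
  refine (measureReal_biUnion_finset_le _ _).trans ?_
  calc ∑ q ∈ (Finset.univ.filter fun q => q ∉ Bad),
        (μ.prod ν).real (({q} : Set (Fin N → Choice n k c)) ×ˢ {G | (q, G) ∈ E})
      ≤ ∑ q ∈ (Finset.univ.filter fun q => q ∉ Bad), μ.real {q} * b := by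
        refine Finset.sum_le_sum fun q hq => ?_
        rw [measureReal_prod_prod]
        exact mul_le_mul_of_nonneg_left (h q (Finset.mem_filter.1 hq).2) measureReal_nonneg
    _ ≤ ∑ q, μ.real {q} * b :=
        Finset.sum_le_sum_of_subset_of_nonneg (Finset.subset_univ _)
          (fun _ _ _ => mul_nonneg measureReal_nonneg hb)
    _ = b := by
        rw [← Finset.sum_mul, sum_measureReal_singleton]
        simp

lemma one_sub_le_measureReal_of_compl_subset {Ω : Type*} [MeasurableSpace Ω] (μ : Measure Ω)
    [IsProbabilityMeasure μ] {S E : Set Ω} {b : ℝ} (h : Eᶜ ⊆ S) (hE : μ.real E ≤ b) :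
    1 - b ≤ μ.real S := by
  have h1 : μ.real Set.univ ≤ μ.real (S ∪ E) := measureReal_mono (fun x _ => by
    by_cases hx : x ∈ E
    · exact Or.inr hx
    · exact Or.inl (h hx)) (measure_ne_top _ _)
  have h2 := measureReal_union_le (μ := μ) S E
  rw [probReal_univ] at h1
  linarith

end CoVer

/-! ### The tree and the sampled subtrees -/

namespace CoVer

variable {n : ℕ}

lemma layer_parent (v : Sym n) : layer (parent v) = layer v - 1 := by
  match v with
  | none => rfl
  | some ⟨⟨0, _⟩, _⟩ => rfl
  | some ⟨⟨ℓ + 1, h⟩, (_, j)⟩ => rfl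

lemma layer_eq_zero {v : Sym n} : layer v = 0 ↔ v = none := by
  match v with
  | none => simp [layer]
  | some ⟨_, _⟩ => simp [layer]

lemma layer_some (ℓ : Fin (n + 1)) (b : Pos ℓ) : layer (some ⟨ℓ, b⟩ : Sym n) = ℓ + 1 := rfl

lemma parent_eq_parent_of_div_eq {ℓ : Fin (n + 1)} {s s' : Bool} {i j : Fin (2 ^ ((ℓ : ℕ) + 1))}
    (h : (i : ℕ) / 2 = j / 2) :
    parent (some ⟨ℓ, (s, i)⟩ : Sym n) = parent (some ⟨ℓ, (s', j)⟩) := by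
  match ℓ, i, j, h with
  | ⟨0, _⟩, _, _, _ => rfl
  | ⟨ℓ + 1, h⟩, i, j, hij => simp only [parent, hij]

lemma iterate_parent_eq_none {r : ℕ} {v : Sym n} (h : layer v ≤ r) : parent^[r] v = none := by
  induction r generalizing v with
  | zero =>
    match v with
    | none => rfl
    | some ⟨_, _⟩ => simp [layer] at h
  | succ r ih =>
    rw [Function.iterate_succ_apply]
    exact ih (by rw [layer_parent]; omega)

/-- The ancestor `d` layers above symbol `j` of a layer is a sibling of symbol `j / 2 ^ d`, whether
symbol `j` is a data symbol or a coded symbol. -/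
lemma iterate_parent (ℓ d : ℕ) (h : ℓ + d < n + 1) (s : Bool) (j : Fin (2 ^ (ℓ + d + 1)))
    (h' : (j : ℕ) / 2 ^ d < 2 ^ (ℓ + 1)) :
    layer (parent^[d] (some ⟨⟨ℓ + d, h⟩, (s, j)⟩ : Sym n)) = ℓ + 1 ∧
      parent (parent^[d] (some ⟨⟨ℓ + d, h⟩, (s, j)⟩ : Sym n)) =
        parent (some ⟨⟨ℓ, by omega⟩, (s, ⟨j / 2 ^ d, h'⟩)⟩) := by
  induction d generalizing s with
  | zero => exact ⟨rfl, by simp⟩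
  | succ d ih =>
    have hdiv : (j : ℕ) / 2 / 2 ^ d = j / 2 ^ (d + 1) :=
      (Nat.div_div_eq_div_mul _ _ _).trans (congrArg _ (pow_succ' 2 d).symm)
    have hj : (j : ℕ) / 2 < 2 ^ (ℓ + d + 1) := by
      have h1 : (j : ℕ) < 2 ^ (ℓ + d + 1 + 1) := j.2
      have h2 : 2 ^ (ℓ + d + 1 + 1) = 2 ^ (ℓ + d + 1) * 2 := pow_succ 2 (ℓ + d + 1)
      omega
    obtain ⟨h1, h2⟩ := ih (by omega) false ⟨j / 2, hj⟩ (by simpa [hdiv] using h')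
    rw [Function.iterate_succ_apply]
    have hp : parent (some ⟨⟨ℓ + (d + 1), h⟩, (s, j)⟩ : Sym n) =
        some ⟨⟨ℓ + d, by omega⟩, (false, ⟨j / 2, hj⟩)⟩ := rfl
    rw [hp]
    refine ⟨h1, h2.trans (parent_eq_parent_of_div_eq ?_)⟩
    simp [hdiv]

/-- A sample of the node is leaf `j` or one of its siblings. -/
def Hit {k c : ℕ} (q : Choice n k c) (j : Fin (2 ^ (n + 1))) : Prop :=
  ∃ t, parent (bottom n (q.2 t)) = parent (leaf n j)

/-- Every symbol has a leaf below it or below one of its siblings, and is desired by all nodes with a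
sample among the siblings of that leaf. -/
lemma exists_hit_imp_desired (v : Sym n) :
    ∃ j, ∀ (k c : ℕ) (q : Choice n k c), Hit q j → Desired q v := by
  match v with
  | none =>
    refine ⟨⟨0, by positivity⟩, fun k c q ⟨t, _⟩ => ⟨t, n + 1, ?_⟩⟩
    rw [iterate_parent_eq_none (by simp [layer, bottom])]
    exact ⟨rfl, rfl⟩
  | some ⟨⟨ℓ, hℓ⟩, (s, i)⟩ =>
    obtain ⟨d, rfl⟩ : ∃ d, n = ℓ + d := ⟨n - ℓ, by omega⟩
    have hi : (i : ℕ) < 2 ^ (ℓ + 1) := i.2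
    have hpow : 2 ^ (ℓ + d + 1) = 2 ^ (ℓ + 1) * 2 ^ d := by ring
    refine ⟨⟨i * 2 ^ d, by rw [hpow]; exact Nat.mul_lt_mul_of_pos_right hi (by positivity)⟩,
      fun k c q ⟨t, ht⟩ => ⟨t, d, ?_⟩⟩
    have hdiv : ∀ j : Fin (2 ^ (ℓ + d + 1)), (j : ℕ) / 2 ^ d < 2 ^ (ℓ + 1) := fun j => by
      rw [Nat.div_lt_iff_lt_mul (by positivity), ← hpow]; exact j.2
    have h1 := iterate_parent (n := ℓ + d) ℓ d (by omega) (q.2 t).1 (q.2 t).2 (hdiv _)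
    have h2 := iterate_parent (n := ℓ + d) ℓ d (by omega) false
      ⟨i * 2 ^ d, by rw [hpow]; exact Nat.mul_lt_mul_of_pos_right hi (by positivity)⟩ (hdiv _)
    refine ⟨h1.1.symm, ?_⟩
    have h3 : parent (parent^[d] (bottom (ℓ + d) (q.2 t))) =
        parent (parent^[d] (leaf (ℓ + d) ⟨i * 2 ^ d, by
          rw [hpow]; exact Nat.mul_lt_mul_of_pos_right hi (by positivity)⟩)) := by
      rw [← Function.iterate_succ_apply' parent, ← Function.iterate_succ_apply' parent,
        Function.iterate_succ_apply, Function.iterate_succ_apply, ht]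
    refine Eq.trans ?_ h3.symm
    refine Eq.trans ?_ h2.2.symm
    exact parent_eq_parent_of_div_eq (by simp)

lemma desired_none {k c : ℕ} (hc : 0 < c) (q : Choice n k c) : Desired q none := by
  refine ⟨⟨0, hc⟩, n + 1, ?_⟩
  rw [iterate_parent_eq_none (by simp [layer, bottom])]
  exact ⟨rfl, rfl⟩

lemma Desired.parent {k c : ℕ} {q : Choice n k c} {v : Sym n} (h : Desired q v) :
    Desired q (parent v) := by
  obtain ⟨t, r, h1, h2⟩ := h
  refine ⟨t, r + 1, ?_⟩
  rw [Function.iterate_succ_apply', layer_parent, layer_parent, h1, h2]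
  exact ⟨rfl, rfl⟩

/-- Each leaf has at least four siblings, itself included, among the symbols of the bottom layer. -/
lemma four_le_card_siblings (j : Fin (2 ^ (n + 1))) [DecidablePred fun b : Pos n =>
    parent (bottom n b) = parent (leaf n j)] :
    4 ≤ (Finset.univ.filter fun b : Pos n => parent (bottom n b) = parent (leaf n j)).card := by
  have hlt : ∀ r : Fin 2, 2 * ((j : ℕ) / 2) + r < 2 ^ (n + 1) := fun r => by
    have h1 := j.2
    have h2 : 2 ^ (n + 1) = 2 ^ n * 2 := pow_succ 2 n
    omega
  have h4 : Fintype.card (Bool × Fin 2) = 4 := by simp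
  rw [← h4, ← Finset.card_univ]
  refine Finset.card_le_card_of_injOn (fun x => (x.1, ⟨2 * ((j : ℕ) / 2) + x.2, hlt x.2⟩)) ?_ ?_
  · rintro ⟨s, r⟩ -
    simp only [Finset.coe_filter, Finset.mem_univ, true_and, Set.mem_ofPred_eq]
    refine parent_eq_parent_of_div_eq ?_
    show (2 * ((j : ℕ) / 2) + r) / 2 = j / 2
    omega
  · rintro ⟨s, r⟩ - ⟨s', r'⟩ - h
    simp only [Prod.mk.injEq, Fin.mk.injEq] at h
    exact Prod.ext h.1 (Fin.ext (Nat.add_left_cancel h.2))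

/-- The samples that make some symbol of `T` desired are at least as frequent in the bottom layer as `T`
is in its layer. -/
lemma exists_card_mul_le (ℓ : Fin (n + 1)) (T : Finset (Pos ℓ)) :
    ∃ B : Finset (Pos n), T.card * Fintype.card (Pos n) ≤ B.card * Fintype.card (Pos ℓ) ∧
      ∀ (k c : ℕ) (q : Choice n k c) (t : Fin c), q.2 t ∈ B →
        ∃ d ∈ T, Desired q (some ⟨ℓ, d⟩) := by
  classical
  obtain ⟨ℓ, hℓ⟩ := ℓ
  obtain ⟨d, rfl⟩ : ∃ d, n = ℓ + d := ⟨n - ℓ, by omega⟩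
  have hpow : 2 ^ (ℓ + d + 1) = 2 ^ (ℓ + 1) * 2 ^ d := by ring
  have hdiv : ∀ j : Fin (2 ^ (ℓ + d + 1)), (j : ℕ) / 2 ^ d < 2 ^ (ℓ + 1) := fun j => by
    rw [Nat.div_lt_iff_lt_mul (by positivity), ← hpow]; exact j.2
  refine ⟨Finset.univ.filter fun b : Pos (ℓ + d) => ((b.1, ⟨b.2 / 2 ^ d, hdiv b.2⟩) : Pos ℓ) ∈ T,
    ?_, ?_⟩
  · have hlt : ∀ (i : Fin (2 ^ (ℓ + 1))) (r : Fin (2 ^ d)), (i : ℕ) * 2 ^ d + r < 2 ^ (ℓ + d + 1) := by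
      intro i r
      rw [hpow]
      have h1 : (i : ℕ) + 1 ≤ 2 ^ (ℓ + 1) := i.2
      have h2 := Nat.mul_le_mul_right (2 ^ d) h1
      have h3 := r.2
      rw [add_mul] at h2
      omega
    have hcard : T.card * 2 ^ d ≤ (Finset.univ.filter fun b : Pos (ℓ + d) =>
        ((b.1, ⟨b.2 / 2 ^ d, hdiv b.2⟩) : Pos ℓ) ∈ T).card := by
      have : T.card * 2 ^ d = (T ×ˢ (Finset.univ : Finset (Fin (2 ^ d)))).card := by
        simp [Finset.card_product]
      rw [this]
      have hq : ∀ (i : ℕ) (r : Fin (2 ^ d)), (i * 2 ^ d + r) / 2 ^ d = i := fun i r => by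
        rw [mul_comm, Nat.mul_add_div (by positivity), Nat.div_eq_of_lt r.2, add_zero]
      refine Finset.card_le_card_of_injOn
        (fun x => (x.1.1, ⟨x.1.2 * 2 ^ d + x.2, hlt x.1.2 x.2⟩)) ?_ ?_
      · rintro ⟨⟨s, i⟩, r⟩ h
        have h' : (s, i) ∈ T := by simpa using h
        simpa [hq] using h'
      · rintro ⟨⟨s, i⟩, r⟩ - ⟨⟨s', i'⟩, r'⟩ - h
        simp only [Prod.mk.injEq, Fin.mk.injEq] at h
        obtain ⟨h1, h2⟩ := h
        have hi : (i : ℕ) = i' := by rw [← hq i r, ← hq i' r', h2]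
        rw [hi] at h2
        exact Prod.ext (Prod.ext h1 (Fin.ext hi)) (Fin.ext (by simpa using h2))
    calc T.card * Fintype.card (Pos (ℓ + d))
        = T.card * 2 ^ d * Fintype.card (Pos ℓ) := by
          simp only [Fintype.card_prod, Fintype.card_bool, Fintype.card_fin]
          rw [hpow]; ring
      _ ≤ _ := Nat.mul_le_mul_right _ hcard
  · intro k c q t ht
    have ht' := (Finset.mem_filter.1 ht).2
    have h1 := iterate_parent (n := ℓ + d) ℓ d (by omega) (q.2 t).1 (q.2 t).2 (hdiv _)
    exact ⟨_, ht', t, d, h1.1.symm, h1.2.symm⟩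

lemma card_sym_le : Fintype.card (Sym n) ≤ 4 * 2 ^ (n + 1) := by
  have h : ∀ m : ℕ, ∑ ℓ : Fin m, Fintype.card (Pos ℓ) + 4 = 4 * 2 ^ m := by
    intro m
    induction m with
    | zero => simp
    | succ m ih =>
      rw [Fin.sum_univ_castSucc]
      simp only [Fin.val_castSucc, Fin.val_last]
      have : Fintype.card (Pos m) = 4 * 2 ^ m := by simp [pow_succ]; ring
      rw [this, pow_succ]; omega
  have := h (n + 1)
  rw [Fintype.card_option, Fintype.card_sigma]
  omega

end CoVer

/-! ### Runs of the protocol -/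

namespace CoVer

variable {n k : ℕ} {F H A Sg : Type*} {C : Scheme n k F H A Sg}

/-- Since the hash function is injective, the Merkle root determines all symbols of the block. -/
lemma Block.hash_eq_of_hashProof (B : Block C) {π : List F} {v : Sym n} {h : H}
    (hp : HashProof C B.root π v h) : h = C.hash (B.val v) := by
  induction π generalizing v h with
  | nil => obtain ⟨rfl, rfl⟩ := hp; rfl
  | cons y π ih =>
    obtain ⟨hv, ⟨g, rfl, rfl⟩, hrest⟩ := hp
    obtain ⟨g', h1, h2⟩ := B.val_parent v hv
    have h3 := C.hash_injective (ih hrest)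
    rw [h1] at h3
    rw [C.pack_injective h3, h2]

lemma Block.eq_val_of_merkleProof (B : Block C) {π : List F} {v : Sym n} {x : F}
    (hp : MerkleProof C B.root v x π) : x = B.val v :=
  C.hash_injective (B.hash_eq_of_hashProof hp)

lemma Block.eq_tx_of_merkleProof (B : Block C) {π : List F} {j : Fin (2 ^ (n + 1))}
    {t : Tx n F H A Sg} (hp : MerkleProof C B.root (leaf n j) (C.enc t) π) : t = B.tx j :=
  C.enc_injective ((B.eq_val_of_merkleProof hp).trans (B.val_leaf j))

lemma Block.exists_merkleProof (B : Block C) (v : Sym n) :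
    ∃ π, MerkleProof C B.root v (B.val v) π := by
  induction hℓ : layer v generalizing v with
  | zero => exact ⟨[], layer_eq_zero.1 hℓ, by rw [layer_eq_zero.1 hℓ]; rfl⟩
  | succ ℓ ih =>
    have hv : v ≠ none := fun h => by simp [h, layer] at hℓ
    obtain ⟨π, hπ⟩ := ih (parent v) (by rw [layer_parent, hℓ]; rfl)
    obtain ⟨g, h1, h2⟩ := B.val_parent v hv
    exact ⟨B.val (parent v) :: π, hv, ⟨g, h1, h2⟩, hπ⟩

variable {chain : ℕ → Block C} {g : ℕ}

lemma not_fraudProof_valid (hB : ∀ j, TxValid chain g ((chain g).tx j))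
    (p : FraudProof n F H A Sg) : ¬ p.Valid chain g := by
  rintro ⟨h1, h2, h3⟩
  have ht := (chain g).eq_tx_of_merkleProof h1
  rw [ht] at h3
  rcases h3 with h3 | ⟨r, hr, hcol⟩
  · exact h3 (hB _).1
  · obtain ⟨hg, hmp⟩ := h2 r hr
    rw [(chain r.2.1).eq_tx_of_merkleProof hmp] at hcol
    exact (hB _).2 _ hg _ hcol

/-- Colliding transactions have the same sender: they spend an output paid to both senders, and the
transaction id determines the funding transaction.  Hence whoever validates the second spending stores
the first. -/
lemma Collide.sender_eq {t t' : Tx n F H A Sg} {g' : ℕ} (h : Collide t t')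
    (ht : WellFormed chain g t) (ht' : WellFormed chain g' t') : t'.sender = t.sender := by
  obtain ⟨a, ha, b, hb, hab⟩ := h
  have key : ∀ {g : ℕ} {t : Tx n F H A Sg} {a : TxInput n F H}, WellFormed chain g t →
      a ∈ t.inputs → ∃ amt, InputOK chain g t.sender a amt := by
    rintro g t a ⟨-, amts, hall, -⟩ ha
    obtain ⟨i, hi, rfl⟩ := List.mem_iff_getElem.1 ha
    exact ⟨_, (List.forall₂_iff_get.1 hall).2 i hi (by rw [← hall.length_eq]; exact hi)⟩
  obtain ⟨x, -, h1, -, s, h2, h3⟩ := key ht ha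
  obtain ⟨x', -, h1', -, s', h2', h3'⟩ := key ht' hb
  simp only [Prod.mk.injEq] at hab
  have hf : a.funding = b.funding := C.hash_injective (by rw [h1, h1', hab.1])
  have hs : s = s' := C.enc_injective (by rw [h2, h2', hf])
  rw [hs, hab.2, h3'] at h3
  simp only [Option.some.injEq, Prod.mk.injEq] at h3
  exact h3.1

variable {N c : ℕ} {G : SimpleGraph (Fin N)} {q : Fin N → Choice n k c}

/-- The event on which the network works: the nodes interested in any given symbol form a connected
graph, and every symbol is desired by some node. -/
structure Covered (B : Block C) (G : SimpleGraph (Fin N)) (q : Fin N → Choice n k c) : Prop where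
  linked : ∀ v, Linked G {i | Interested B (q i) v}
  desired : ∀ v, ∃ i, Desired (q i) v

/-- The root symbol interests all nodes, so the whole network is connected, and fraud proofs reach
everybody. -/
lemma Covered.linked_univ (hc : 0 < c) {B : Block C} (h : Covered B G q) : Linked G Set.univ := by
  have := h.linked none
  have huniv : {i | Interested B (q i) none} = Set.univ :=
    Set.eq_univ_of_forall fun i => Or.inl (desired_none hc (q i))
  rwa [huniv] at this

variable [AddCommGroup F] {adv : Fin N → Msg n F H A Sg → Prop} {R : Set (Sym n)}

/-- Whatever an honest node holds, in particular what it produced itself, passes the check of messages. -/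
lemma Holds.valid {i : Fin N} {m : Msg n F H A Sg} (h : Holds chain g G q adv i m) :
    m.Valid chain g := by
  induction h with
  | inject _ hv _ => exact hv
  | gossip _ _ _ _ ih => exact ih
  | peel he hd hdes hx' _ hsum hpack hslot ihx' _ =>
    have := ihx' _ hdes.parent (by rw [layer_parent, layer_some]; simp)
    exact ⟨by simp, ⟨_, hpack, hslot⟩, this⟩
  | codingFraud he hd hdes hx' _ hsum hpack hslot ihx' iho =>
    have := ihx' _ hdes.parent (by rw [layer_parent, layer_some]; simp)
    exact ⟨⟨by simp, ⟨_, hpack, rfl⟩, this⟩, fun b hb => iho b hb, he, hd, hsum,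
      fun h => hslot h.symm⟩
  | malformed _ hs hw ih =>
    exact ⟨ih, fun q hq => by simp at hq, Or.inl hw⟩
  | doubleSpend _ hs hg hs' hmp hcol ih =>
    refine ⟨ih, fun q hq => ?_, Or.inr ⟨_, rfl, hcol⟩⟩
    obtain rfl : _ = q := by simpa using hq
    exact ⟨hg, hmp⟩

lemma Holds.eq_val {i : Fin N} {v : Sym n} {x : F} {π : List F}
    (h : Holds chain g G q adv i (.symbol v x π)) : x = (chain g).val v :=
  (chain g).eq_val_of_merkleProof h.valid

/-- A message reaches all nodes that want it, once it has reached one of them. -/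
lemma Holds.spread {m : Msg n F H A Sg} (hl : Linked G {i | Wants (chain g) (q i) m}) {i j : Fin N}
    (hi : Wants (chain g) (q i) m) (h : Holds chain g G q adv i m) (hj : Wants (chain g) (q j) m) :
    Holds chain g G q adv j m := by
  have := hl {i | Wants (chain g) (q i) m ∧ Holds chain g G q adv i m} (fun _ h => h.1) ⟨i, hi, h⟩
    (fun a ha b hb hab => ⟨hb, ha.2.gossip hab ha.1 hb⟩)
  have hj' : j ∈ {i | Wants (chain g) (q i) m} := hj
  rw [← this] at hj'
  exact hj'.2

/-- Coding fraud proofs are impossible for a block that respects the parity equations. -/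
lemma not_codingFraudProof_valid (hB : CodeValid (chain g)) (p : CodingFraudProof n F H) :
    ¬ p.Valid C (chain g).root := by
  classical
  rintro ⟨h1, h2, h3, h4, h5, h6⟩
  apply h6
  rw [(chain g).hash_eq_of_hashProof h1]
  congr 1
  have h7 := hB _ _ h3
  rw [← Finset.add_sum_erase _ _ h4] at h7
  have h8 : ∑ b ∈ p.eqn.erase p.d, p.others b =
      ∑ b ∈ p.eqn.erase p.d, (chain g).val (some ⟨p.ℓ, b⟩) :=
    Finset.sum_congr rfl fun b hb => (chain g).eq_val_of_merkleProof (h2 b hb)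
  rw [h8] at h5
  exact add_right_cancel (h5.trans h7.symm)

lemma Covered.spread_coding (hc : 0 < c) (h : Covered (chain g) G q) {i j : Fin N}
    {p : CodingFraudProof n F H} (hp : Holds chain g G q adv i (.coding p)) :
    Holds chain g G q adv j (.coding p) :=
  hp.spread (by simpa [Wants] using h.linked_univ hc) trivial trivial

lemma Covered.spread_fraud (hc : 0 < c) (h : Covered (chain g) G q) {i j : Fin N}
    {p : FraudProof n F H A Sg} (hp : Holds chain g G q adv i (.fraud p)) :
    Holds chain g G q adv j (.fraud p) :=
  hp.spread (by simpa [Wants] using h.linked_univ hc) trivial trivial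

lemma Covered.obtains_of_mem (h : Covered (chain g) G q) (hR : Releases chain g q R adv)
    {v : Sym n} (hv : v ∈ R) {i : Fin N} (hi : Interested (chain g) (q i) v) :
    ∃ π, Holds chain g G q adv i (.symbol v ((chain g).val v) π) := by
  obtain ⟨i', x, π, h1, h2, h3⟩ := hR v hv ⟨i, hi⟩
  have h4 : Holds chain g G q adv i' (.symbol v x π) := .inject h3 h2 h1
  rw [← h4.eq_val]
  exact ⟨π, h4.spread (h.linked v) h1 hi⟩

/-- A node that holds all symbols of the equation `e` but the desired symbol `d`, and its desired symbols
in the layers above, either recovers `d` or produces a coding fraud proof. -/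
lemma Holds.peel_or_codingFraud {i : Fin N} {ℓ : Fin (n + 1)} {e : Finset (Pos ℓ)} {d : Pos ℓ}
    (he : e ∈ C.code ℓ) (hd : d ∈ e) (hdes : Desired (q i) (some ⟨ℓ, d⟩))
    (habove : ∀ w, Desired (q i) w → layer w ≤ ℓ →
      ∃ π, Holds chain g G q adv i (.symbol w ((chain g).val w) π))
    (hothers : ∀ b ∈ e.erase d,
      ∃ π, Holds chain g G q adv i (.symbol (some ⟨ℓ, b⟩) ((chain g).val (some ⟨ℓ, b⟩)) π)) :
    (∑ b ∈ e, (chain g).val (some ⟨ℓ, b⟩) = 0 ∧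
      ∃ π, Holds chain g G q adv i (.symbol (some ⟨ℓ, d⟩) ((chain g).val (some ⟨ℓ, d⟩)) π)) ∨
    ∃ p, Holds chain g G q adv i (.coding p) := by
  classical
  have h1 : ∀ w, ∃ π, Desired (q i) w → layer w ≤ ℓ →
      Holds chain g G q adv i (.symbol w ((chain g).val w) π) := fun w => by
    by_cases hw : Desired (q i) w ∧ layer w ≤ ℓ
    · obtain ⟨π, hπ⟩ := habove w hw.1 hw.2
      exact ⟨π, fun _ _ => hπ⟩
    · exact ⟨[], fun a b => absurd ⟨a, b⟩ hw⟩
  choose π' hπ' using h1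
  have h2 : ∀ b, ∃ π, b ∈ e.erase d →
      Holds chain g G q adv i (.symbol (some ⟨ℓ, b⟩) ((chain g).val (some ⟨ℓ, b⟩)) π) := fun b => by
    by_cases hb : b ∈ e.erase d
    · obtain ⟨π, hπ⟩ := hothers b hb
      exact ⟨π, fun _ => hπ⟩
    · exact ⟨[], fun a => absurd a hb⟩
  choose paths hpaths using h2
  obtain ⟨hs, hpack, hslot⟩ := (chain g).val_parent (some ⟨ℓ, d⟩) (by simp)
  set x : F := -∑ b ∈ e.erase d, (chain g).val (some ⟨ℓ, b⟩) with hx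
  have hsum : x + ∑ b ∈ e.erase d, (chain g).val (some ⟨ℓ, b⟩) = 0 := by rw [hx]; abel
  by_cases hh : hs (slot (some ⟨ℓ, d⟩)) = C.hash x
  · have h3 := Holds.peel (x' := (chain g).val) he hd hdes hπ' hpaths hsum hpack hh
    have h4 := h3.eq_val
    rw [h4] at h3 hsum
    rw [Finset.add_sum_erase _ (fun b => (chain g).val (some ⟨ℓ, b⟩)) hd] at hsum
    exact Or.inl ⟨hsum, _, h3⟩
  · exact Or.inr ⟨_, Holds.codingFraud (x' := (chain g).val) he hd hdes hπ' hpaths hsum hpack hh⟩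

/-- Collaborative decoding: if the block is available, then, layer by layer and along the peeling
decoder in each layer, every symbol reaches all nodes interested in it, unless coding fraud is
discovered. -/
lemma Covered.obtains (h : Covered (chain g) G q) (hav : Available C R)
    (hR : Releases chain g q R adv) (hcf : ∀ i p, ¬ Holds chain g G q adv i (.coding p))
    (v : Sym n) (i : Fin N) (hi : Interested (chain g) (q i) v) :
    ∃ π, Holds chain g G q adv i (.symbol v ((chain g).val v) π) := by
  induction hℓ : layer v using Nat.strong_induction_on generalizing v i with
  | _ m ih =>
    match v with
    | none => exact h.obtains_of_mem hR hav.1 hi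
    | some ⟨ℓ, b⟩ =>
      have habove : ∀ i w, Desired (q i) w → layer w ≤ ℓ →
          ∃ π, Holds chain g G q adv i (.symbol w ((chain g).val w) π) :=
        fun i w hw hle => ih (layer w) (by rw [← hℓ, layer_some]; omega) w i (Or.inl hw) rfl
      have hpeel := hav.2 ℓ b
      clear ih hℓ
      induction hpeel generalizing i with
      | known hb => exact h.obtains_of_mem hR hb hi
      | @peel e a he ha hothers ihp =>
        -- Some node desires `a`, hence needs the other symbols of the equation.
        obtain ⟨i', hi'⟩ := h.desired (some ⟨ℓ, a⟩)
        have hpc := Holds.peel_or_codingFraud (G := G) (adv := adv) he ha hi' (habove i')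
          (fun b hb => ihp b (Finset.mem_of_mem_erase hb) (Finset.ne_of_mem_erase hb) i'
            (Or.inr (Or.inl ⟨ℓ, e, he, b, Finset.mem_of_mem_erase hb, rfl, a, ha, hi'⟩)))
        rcases hpc with ⟨-, π, hπ⟩ | ⟨p, hp⟩
        · exact ⟨π, hπ.spread (h.linked _) (Or.inl hi') hi⟩
        · exact absurd hp (hcf i' p)

/-- Completeness: a valid and available block is accepted. -/
lemma Covered.accepts (h : Covered (chain g) G q) (hB : BlockValid chain g) (hav : Available C R)
    (hR : Releases chain g q R adv) (i : Fin N) : Accepts chain g G q adv i := by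
  have hcf : ∀ i p, ¬ Holds chain g G q adv i (.coding p) :=
    fun i p hp => not_codingFraudProof_valid hB.2 p hp.valid
  refine ⟨fun v hv => ?_, fun p hp => not_fraudProof_valid hB.1 p hp.valid, hcf i⟩
  obtain ⟨π, hπ⟩ := h.obtains hav hR hcf v i (Or.inl hv)
  exact ⟨_, π, hπ⟩

/-- Soundness, coding fraud: the violated equation is checked by a node that desires one of its
symbols. -/
lemma Covered.rejects_of_not_codeValid (hc : 0 < c) (h : Covered (chain g) G q)
    (hB : ¬ CodeValid (chain g)) (hav : Available C R) (hR : Releases chain g q R adv) (i : Fin N) :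
    Rejects chain g G q adv i := by
  classical
  by_cases hcf : ∃ i p, Holds chain g G q adv i (.coding p)
  · obtain ⟨i', p, hp⟩ := hcf
    exact fun hacc => hacc.2.2 p (h.spread_coding hc hp)
  · push Not at hcf
    have hob := h.obtains hav hR hcf
    simp only [CodeValid, not_forall] at hB
    obtain ⟨ℓ, e, he, hne⟩ := hB
    obtain ⟨d, hd⟩ : e.Nonempty := by
      by_contra hemp
      rw [Finset.not_nonempty_iff_eq_empty] at hemp
      exact hne (by simp [hemp])
    obtain ⟨i', hi'⟩ := h.desired (some ⟨ℓ, d⟩)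
    rcases Holds.peel_or_codingFraud (G := G) (adv := adv) he hd hi'
      (fun w hw _ => hob w i' (Or.inl hw))
      (fun b hb => hob _ i' (Or.inr (Or.inl ⟨ℓ, e, he, b, Finset.mem_of_mem_erase hb, rfl, d, hd,
        hi'⟩))) with ⟨hz, -⟩ | ⟨p, hp⟩
    · exact absurd hz hne
    · exact absurd hp (hcf i' p)

/-- Soundness, invalid transactions: some node of the section of the sender issues a fraud proof. -/
lemma Covered.rejects_of_not_txValid (hc : 0 < c) (h : Covered (chain g) G q)
    (hpast : ∀ g' < g, ∀ j, TxValid chain g' ((chain g').tx j)) {j : Fin (2 ^ (n + 1))}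
    (hB : ¬ TxValid chain g ((chain g).tx j)) {i' : Fin N}
    (hi' : C.sect ((chain g).tx j).sender = (q i').1)
    (hav : Available C R) (hR : Releases chain g q R adv) (i : Fin N) :
    Rejects chain g G q adv i := by
  by_cases hcf : ∃ i p, Holds chain g G q adv i (.coding p)
  · obtain ⟨i', p, hp⟩ := hcf
    exact fun hacc => hacc.2.2 p (h.spread_coding hc hp)
  · push Not at hcf
    obtain ⟨π, hπ⟩ := h.obtains hav hR hcf (leaf n j) i' (Or.inr (Or.inr ⟨j, rfl, hi'⟩))
    rw [(chain g).val_leaf] at hπ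
    suffices hfr : ∃ p, Holds chain g G q adv i' (.fraud p) by
      obtain ⟨p, hp⟩ := hfr
      exact fun hacc => hacc.2.1 p (h.spread_fraud hc hp)
    by_cases hwf : WellFormed chain g ((chain g).tx j)
    · have hcol : ∃ g' < g, ∃ j', Collide ((chain g).tx j) ((chain g').tx j') := by
        by_contra hno
        push Not at hno
        exact hB ⟨hwf, hno⟩
      obtain ⟨g', hg', j', hcol⟩ := hcol
      obtain ⟨π', hπ'⟩ := (chain g').exists_merkleProof (leaf n j')
      rw [(chain g').val_leaf] at hπ'
      have hs := hcol.sender_eq hwf (hpast g' hg' j').1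
      exact ⟨_, .doubleSpend hπ hi' hg' (by rw [hs, hi']) hπ' hcol⟩
    · exact ⟨_, .malformed hπ hi' hwf⟩

/-- A symbol held by an honest node can be recovered by peeling from the released symbols. -/
lemma Holds.peeled (hH : Hides chain g R adv) {i : Fin N} {m : Msg n F H A Sg}
    (h : Holds chain g G q adv i m) :
    (∀ x π, m = .symbol none x π → none ∈ R) ∧
    ∀ ℓ b x π, m = .symbol (some ⟨ℓ, b⟩) x π → Peeled (C.code ℓ) {b | some ⟨ℓ, b⟩ ∈ R} b := by
  induction h with
  | inject ha hv _ =>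
    refine ⟨?_, ?_⟩
    · rintro x π rfl; exact hH _ _ _ _ ha hv
    · rintro ℓ b x π rfl; exact .known (hH _ _ _ _ ha hv)
  | gossip _ _ _ _ ih => exact ih
  | @peel i ℓ e d _ _ _ _ _ _ he hd _ _ _ _ _ _ _ iho =>
    refine ⟨fun x π hm => by simp at hm, ?_⟩
    intro ℓ' b x π hm
    simp only [Msg.symbol.injEq, Option.some.injEq, Sigma.mk.injEq] at hm
    obtain ⟨⟨rfl, hb⟩, -, -⟩ := hm
    obtain rfl := eq_of_heq hb
    exact .peel he hd fun b hb hne => (iho b (Finset.mem_erase.2 ⟨hne, hb⟩)).2 _ _ _ _ rfl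
  | codingFraud => exact ⟨fun _ _ hm => by simp at hm, fun _ _ _ _ hm => by simp at hm⟩
  | malformed => exact ⟨fun _ _ hm => by simp at hm, fun _ _ _ _ hm => by simp at hm⟩
  | doubleSpend => exact ⟨fun _ _ hm => by simp at hm, fun _ _ _ _ hm => by simp at hm⟩

lemma rejects_of_none_notMem (hc : 0 < c) (hH : Hides chain g R adv) (hR : none ∉ R) (i : Fin N) :
    Rejects chain g G q adv i := fun hacc => by
  obtain ⟨x, π, h⟩ := hacc.1 none (desired_none hc _)
  exact hR ((h.peeled hH).1 _ _ rfl)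

lemma rejects_of_desired_not_peeled (hH : Hides chain g R adv) {ℓ : Fin (n + 1)} {d : Pos ℓ}
    (hd : ¬ Peeled (C.code ℓ) {b | some ⟨ℓ, b⟩ ∈ R} d) {i : Fin N}
    (hdes : Desired (q i) (some ⟨ℓ, d⟩)) : Rejects chain g G q adv i := fun hacc => by
  obtain ⟨x, π, h⟩ := hacc.1 _ hdes
  exact hd ((h.peeled hH).2 _ _ _ _ rfl)

/-- The symbols that the peeling decoder does not recover form a stopping set, if there are any. -/
lemma isStoppingSet_not_peeled {S : Type*} [Fintype S] {P : Finset (Finset S)} {K : Set S}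
    [DecidablePred fun a => ¬ Peeled P K a] {a : S} (ha : ¬ Peeled P K a) :
    IsStoppingSet P (Finset.univ.filter fun a => ¬ Peeled P K a) := by
  intro hall
  have key : ∀ b, Peeled P {b | b ∉ Finset.univ.filter fun a => ¬ Peeled P K a} b →
      Peeled P K b := by
    intro b hb
    induction hb with
    | known h => simpa using h
    | peel he hae _ ih => exact .peel he hae ih
  exact ha (key a (hall a))

end CoVer

/-! ### The failure probability -/

namespace CoVer

open MeasureTheory ProbabilityTheory

variable {n k c N : ℕ}

instance instIsProbabilityMeasureLaw [NeZero k] (p : unitInterval) :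
    IsProbabilityMeasure (law n k c N p) := by
  unfold law; infer_instance

lemma law_real_fst_le [NeZero k] (p : unitInterval) (Bad : Set (Fin N → Choice n k c)) :
    (law n k c N p).real {ω | ω.1 ∈ Bad} ≤
      (uniformOn (Set.univ : Set (Fin N → Choice n k c))).real Bad := by
  have h := law_real_le p {ω : (Fin N → Choice n k c) × SimpleGraph (Fin N) | ω.1 ∈ Bad} Bad le_rfl
    (fun q hq => by simp [hq])
  simpa using h

/-- One node: its `c ≥ L / k` samples all miss the four siblings of a leaf. -/
lemma card_not_hit_le (hk : 1 ≤ k) (hc : (2 : ℝ) ^ (n + 1) / k ≤ c) (j : Fin (2 ^ (n + 1)))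
    [DecidablePred fun q : Choice n k c => ¬ Hit q j] :
    ((Finset.univ.filter fun q : Choice n k c => ¬ Hit q j).card : ℝ) /
      Fintype.card (Choice n k c) ≤ Real.exp (-(2 / k)) := by
  classical
  set B : Finset (Pos n) :=
    Finset.univ.filter fun b : Pos n => parent (bottom n b) = parent (leaf n j) with hB
  have hset : (Finset.univ.filter fun q : Choice n k c => ¬ Hit q j) =
      Finset.univ.filter fun q : Choice n k c => ∀ t, q.2 t ∉ B := by
    ext q; simp [Hit, hB]
  rw [hset, card_choice_forall_notMem hk]
  have h4 : (4 : ℝ) ≤ B.card := by exact_mod_cast four_le_card_siblings j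
  have hBle : (B.card : ℝ) ≤ Fintype.card (Pos n) := by exact_mod_cast Finset.card_le_univ B
  have hP : (Fintype.card (Pos n) : ℝ) = 2 * 2 ^ (n + 1) := by simp
  have hL : (0 : ℝ) < 2 ^ (n + 1) := by positivity
  have hk0 : (0 : ℝ) < k := by exact_mod_cast hk
  have h1 : 2 / (2 : ℝ) ^ (n + 1) ≤ B.card / Fintype.card (Pos n) := by
    rw [hP, div_le_div_iff₀ hL (by positivity)]; nlinarith
  have h2 : (B.card : ℝ) / Fintype.card (Pos n) ≤ 1 := by
    rw [div_le_one (by rw [hP]; positivity)]; exact hBle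
  calc (1 - (B.card : ℝ) / Fintype.card (Pos n)) ^ c
      ≤ Real.exp (-(2 / 2 ^ (n + 1))) ^ c :=
        pow_le_pow_left₀ (by linarith)
          (by linarith [Real.add_one_le_exp (-(2 / (2 : ℝ) ^ (n + 1)))]) _
    _ = Real.exp (-(c * (2 / 2 ^ (n + 1)))) := by rw [← Real.exp_nat_mul]; ring_nf
    _ ≤ _ := by
        apply Real.exp_le_exp.2
        have h3 : (2 : ℝ) ^ (n + 1) / k * (2 / 2 ^ (n + 1)) ≤ c * (2 / 2 ^ (n + 1)) := by gcongr
        have h5 : (2 : ℝ) ^ (n + 1) / k * (2 / 2 ^ (n + 1)) = 2 / k := by field_simp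
        linarith

/-- The Chernoff bound `2 ^ a (1 - ρ / 2) ^ N` for `a = 3 N / (4 k)`, one node at a time.  For `k = 1` there
is little room: the threshold `3 / 4` has to stay below `1 - exp (-2) = 0.864…` and above `1 / 2`. -/
lemma two_rpow_mul_le (hk : 1 ≤ k) {ρ : ℝ} (hρ : 1 - Real.exp (-(2 / k)) ≤ ρ) :
    (2 : ℝ) ^ (3 / (4 * k) : ℝ) * (1 - ρ / 2) ≤ Real.exp (-(1 / (8 * (4 * k - 1)))) := by
  have hk0 : (0 : ℝ) < k := by exact_mod_cast hk
  rcases hk.eq_or_lt with rfl | hk2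
  · -- Compare fourth powers.
    have he2 : Real.exp (-2) ≤ 0.1354 := by
      have h1 : Real.exp (-2) = (Real.exp 1)⁻¹ ^ 2 := by
        rw [← Real.exp_neg, ← Real.exp_nat_mul]; norm_num
      have h2 : (Real.exp 1)⁻¹ ≤ 0.36788 := by
        rw [inv_le_comm₀ (Real.exp_pos 1) (by norm_num)]
        have := Real.exp_one_gt_d9
        norm_num at this ⊢
        linarith
      rw [h1]
      calc (Real.exp 1)⁻¹ ^ 2 ≤ 0.36788 ^ 2 := by gcongr
        _ ≤ _ := by norm_num
    norm_num at hρ ⊢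
    have h1 : 1 - ρ / 2 ≤ 0.5677 := by norm_num at he2 ⊢; linarith
    have h2 : ((2 : ℝ) ^ (3 / 4 : ℝ) * 0.5677) ≤ Real.exp (-(1 / 24)) := by
      refine le_of_pow_le_pow_left₀ (n := 4) (by norm_num) (Real.exp_pos _).le ?_
      rw [mul_pow, ← Real.rpow_natCast, ← Real.rpow_mul (by norm_num), ← Real.exp_nat_mul]
      have h3 := Real.add_one_le_exp (-(1 / 6))
      have h4 : ((4 : ℕ) : ℝ) * -(1 / 24) = -(1 / 6) := by norm_num
      have h5 : (2 : ℝ) ^ (3 / 4 * ((4 : ℕ) : ℝ)) = 8 := by norm_num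
      rw [h4, h5]
      norm_num at h3 ⊢
      linarith
    calc (2 : ℝ) ^ (3 / 4 : ℝ) * (1 - ρ / 2) ≤ 2 ^ (3 / 4 : ℝ) * 0.5677 := by gcongr
      _ ≤ _ := h2
  · have hk2' : (2 : ℝ) ≤ k := by exact_mod_cast hk2
    set x : ℝ := 2 / k with hx
    have hx0 : 0 < x := by positivity
    have hx1 : x ≤ 1 := by rw [hx, div_le_one hk0]; exact hk2'
    have hex : Real.exp (-x) ≤ 1 - 0.56 * x := by
      have h1 := Real.quadratic_le_exp_of_nonneg hx0.le
      rw [Real.exp_neg, inv_le_comm₀ (Real.exp_pos x) (by linarith)]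
      refine le_trans ?_ h1
      rw [inv_le_iff_one_le_mul₀ (by linarith)]
      nlinarith [mul_nonneg hx0.le (sub_nonneg.2 hx1),
        mul_nonneg (mul_nonneg hx0.le hx0.le) (sub_nonneg.2 hx1)]
    have hρ2 : 1 - ρ / 2 ≤ Real.exp (-(0.28 * x)) := by
      have := Real.add_one_le_exp (-(0.28 * x))
      linarith
    calc (2 : ℝ) ^ (3 / (4 * k) : ℝ) * (1 - ρ / 2)
        ≤ (2 : ℝ) ^ (3 / (4 * k) : ℝ) * Real.exp (-(0.28 * x)) := by gcongr
      _ = Real.exp (Real.log 2 * (3 / (4 * k)) + -(0.28 * x)) := by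
          rw [Real.rpow_def_of_pos (by norm_num), ← Real.exp_add]
      _ ≤ _ := by
          apply Real.exp_le_exp.2
          have h1 : Real.log 2 * (3 / (4 * k)) = Real.log 2 * 0.75 / k := by field_simp; norm_num
          have h2 : 1 / (8 * (4 * (k : ℝ) - 1)) ≤ (1 / 28) / k := by
            rw [div_le_div_iff₀ (by linarith) hk0]; linarith
          have h3 : Real.log 2 * 0.75 / k ≤ 0.52 / k := by
            gcongr
            have := Real.log_two_lt_d9
            norm_num at this ⊢
            linarith
          have h4 : 0.28 * x = 0.56 / k := by rw [hx]; ring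
          have h5 : (0.52 : ℝ) / k + (1 / 28) / k ≤ 0.56 / k := by
            rw [← add_div]; gcongr; norm_num
          linarith

/-- Few nodes desire a given symbol only with small probability. -/
lemma uniformOn_real_card_desired_lt_le (hk : 1 ≤ k) (hc : (2 : ℝ) ^ (n + 1) / k ≤ c) (v : Sym n)
    [DecidablePred fun q : Choice n k c => Desired q v] :
    (uniformOn (Set.univ : Set (Fin N → Choice n k c))).real
        {q | ((Finset.univ.filter fun i => Desired (q i) v).card : ℝ) < 3 * N / (4 * k)} ≤
      Real.exp (-((N : ℝ) / (8 * (4 * k - 1)))) := by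
  classical
  have : NeZero k := ⟨by omega⟩
  obtain ⟨j, hj⟩ := exists_hit_imp_desired v
  have hsub : {q : Fin N → Choice n k c |
      ((Finset.univ.filter fun i => Desired (q i) v).card : ℝ) < 3 * N / (4 * k)} ⊆
      {q | ((Finset.univ.filter fun i => Hit (q i) j).card : ℝ) < 3 * N / (4 * k)} := by
    intro q hq
    simp only [Set.mem_ofPred_eq] at hq ⊢
    refine lt_of_le_of_lt ?_ hq
    exact_mod_cast Finset.card_le_card
      (Finset.monotone_filter_right _ fun i _ h => hj k c (q i) h)
  refine (measureReal_mono hsub (measure_ne_top _ _)).trans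
    ((uniformOn_real_card_lt_le N (fun q => Hit q j) _).trans ?_)
  set ρ : ℝ := ((Finset.univ.filter fun q : Choice n k c => Hit q j).card : ℝ) /
    Fintype.card (Choice n k c) with hρ
  have hQ : (0 : ℝ) < Fintype.card (Choice n k c) := by exact_mod_cast Fintype.card_pos
  have hmiss := card_not_hit_le (c := c) hk hc j
  have hadd := Finset.card_filter_add_card_filter_not (s := (Finset.univ : Finset (Choice n k c)))
    (fun q => Hit q j)
  have hadd' : ((Finset.univ.filter fun q : Choice n k c => Hit q j).card : ℝ) +
      (Finset.univ.filter fun q : Choice n k c => ¬ Hit q j).card =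
      Fintype.card (Choice n k c) := by
    rw [← Finset.card_univ]; exact_mod_cast hadd
  have hρ1 : 1 - Real.exp (-(2 / k)) ≤ ρ := by
    have : ρ = 1 - ((Finset.univ.filter fun q : Choice n k c => ¬ Hit q j).card : ℝ) /
        Fintype.card (Choice n k c) := by
      rw [hρ, eq_sub_iff_add_eq, ← add_div, hadd', div_self hQ.ne']
    linarith
  have hρ2 : ρ ≤ 1 := by
    rw [hρ, div_le_one hQ, ← hadd']; simp
  have hstep := two_rpow_mul_le hk hρ1
  have h0 : 0 ≤ (2 : ℝ) ^ (3 / (4 * k) : ℝ) * (1 - ρ / 2) :=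
    mul_nonneg (by positivity) (by linarith)
  calc (2 : ℝ) ^ (3 * N / (4 * k) : ℝ) * (1 - ρ / 2) ^ N
      = ((2 : ℝ) ^ (3 / (4 * k) : ℝ) * (1 - ρ / 2)) ^ N := by
        rw [mul_pow, ← Real.rpow_natCast ((2 : ℝ) ^ (3 / (4 * k) : ℝ)),
          ← Real.rpow_mul (by norm_num)]
        congr 2; ring
    _ ≤ Real.exp (-(1 / (8 * (4 * k - 1)))) ^ N := pow_le_pow_left₀ h0 hstep _
    _ = _ := by rw [← Real.exp_nat_mul]; congr 1; ring

lemma uniformOn_real_forall_not_hit_le (hk : 1 ≤ k) (hc : (2 : ℝ) ^ (n + 1) / k ≤ c)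
    (j : Fin (2 ^ (n + 1))) :
    (uniformOn (Set.univ : Set (Fin N → Choice n k c))).real {q | ∀ i, ¬ Hit (q i) j} ≤
      Real.exp (-(2 * (N / k))) := by
  classical
  have hset : {q : Fin N → Choice n k c | ∀ i, ¬ Hit (q i) j} =
      {q | ∀ i, q i ∈ Finset.univ.filter fun q : Choice n k c => ¬ Hit q j} := by ext q; simp
  rw [hset, uniformOn_real_forall_mem N (fun _ => _), Finset.prod_const, Finset.card_univ,
    Fintype.card_fin]
  refine (pow_le_pow_left₀ (by positivity) (card_not_hit_le hk hc j) _).trans (le_of_eq ?_)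
  rw [← Real.exp_nat_mul]; congr 1; ring

lemma uniformOn_real_forall_fst_ne_le (hk : 1 ≤ k) (s : Fin k) :
    (uniformOn (Set.univ : Set (Fin N → Choice n k c))).real {q | ∀ i, (q i).1 ≠ s} ≤
      Real.exp (-(N / k)) := by
  classical
  have hset : {q : Fin N → Choice n k c | ∀ i, (q i).1 ≠ s} =
      {q | ∀ i, q i ∈ Finset.univ.filter fun q : Choice n k c => q.1 ≠ s} := by ext q; simp
  rw [hset, uniformOn_real_forall_mem N (fun _ => _), Finset.prod_const, Finset.card_univ,
    Fintype.card_fin]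
  have h1 := Real.add_one_le_exp (-(1 / (k : ℝ)))
  refine (pow_le_pow_left₀ (by positivity) (b := Real.exp (-(1 / (k : ℝ)))) ?_ _).trans
    (le_of_eq ?_)
  · rw [card_choice_fst_ne hk s]; linarith
  · rw [← Real.exp_nat_mul]; congr 1; ring

section
variable {F H A Sg : Type*} {C : Scheme n k F H A Sg}

/-- The nodes interested in a symbol are at least `3 N / (4 k)` in number up to a small probability, and
then form a connected graph up to a small conditional probability. -/
lemma law_real_not_linked_le (hk : 1 ≤ k) (hc : (2 : ℝ) ^ (n + 1) / k ≤ c) (B : Block C)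
    (p : unitInterval) {lam : ℝ} (hA : 24 ≤ (N : ℝ) / (2 * k))
    (hw : ((N : ℝ) / (2 * k)) ^ (1 - lam) ≤ 1 / 8)
    (hp : lam * Real.log ((N : ℝ) / (2 * k)) ≤ p * ((N : ℝ) / (2 * k))) (v : Sym n) :
    (law n k c N p).real {ω | ¬ Linked ω.2 {i | Interested B (ω.1 i) v}} ≤
      Real.exp (-((N : ℝ) / (8 * (4 * k - 1)))) + ((N : ℝ) / (2 * k)) ^ (1 - lam) := by
  classical
  have : NeZero k := ⟨by omega⟩
  have hk0 : (0 : ℝ) < k := by exact_mod_cast hk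
  refine (law_real_le p _ {q | ((Finset.univ.filter fun i => Desired (q i) v).card : ℝ) <
    3 * N / (4 * k)} (b := ((N : ℝ) / (2 * k)) ^ (1 - lam)) (by positivity) ?_).trans
    (add_le_add_left (uniformOn_real_card_desired_lt_le hk hc v) _)
  intro q hq
  set W : Finset (Fin N) := Finset.univ.filter fun i => Interested B (q i) v with hW
  have hWset : {i | Interested B (q i) v} = (W : Set (Fin N)) := by ext i; simp [hW]
  simp only [Set.mem_ofPred_eq, not_lt] at hq
  have hcard : 3 / 2 * ((N : ℝ) / (2 * k)) ≤ W.card := by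
    have h1 : (Finset.univ.filter fun i => Desired (q i) v).card ≤ W.card :=
      Finset.card_le_card (Finset.monotone_filter_right _ fun i _ h => Or.inl h)
    have h2 : ((Finset.univ.filter fun i => Desired (q i) v).card : ℝ) ≤ W.card := by
      exact_mod_cast h1
    have h3 : 3 / 2 * ((N : ℝ) / (2 * k)) = 3 * N / (4 * k) := by ring
    linarith
  simp only [Set.mem_ofPred_eq, hWset]
  exact (binomialRandom_not_linked_le p W).trans
    (sum_cut_le_rpow W p.2.2 hA hw hp hcard)

/-- The failure event of the network: the choices and the graph do not cover the block, or no node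
validates the section `s`. -/
def Uncovered (B : Block C) (s : Fin k) (c N : ℕ) :
    Set ((Fin N → Choice n k c) × SimpleGraph (Fin N)) :=
  {ω | ¬ Covered B ω.2 ω.1 ∨ ∀ i, (ω.1 i).1 ≠ s}

lemma law_real_uncovered_le (hk : 1 ≤ k) (hc : (2 : ℝ) ^ (n + 1) / k ≤ c) (B : Block C)
    (s : Fin k) (p : unitInterval) {lam : ℝ} (hlam : 0 < lam) (hA : 24 ≤ (N : ℝ) / (2 * k))
    (hw : ((N : ℝ) / (2 * k)) ^ (1 - lam) ≤ 1 / 8)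
    (hp : lam * Real.log ((N : ℝ) / (2 * k)) ≤ p * ((N : ℝ) / (2 * k)))
    (hN : Real.log (2 ^ (n + 1)) + lam ≤ (N : ℝ) / k) :
    (law n k c N p).real (Uncovered B s c N) ≤ Real.exp (-lam) +
      4 * 2 ^ (n + 1) * (Real.exp (-((N : ℝ) / (8 * (4 * k - 1)))) +
        ((N : ℝ) / (2 * k)) ^ (1 - lam)) := by
  classical
  have : NeZero k := ⟨by omega⟩
  set μ := law n k c N p
  set L : ℝ := 2 ^ (n + 1) with hL
  have hL2 : 2 ≤ L := by
    rw [hL, pow_succ]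
    have : (1 : ℝ) ≤ 2 ^ n := one_le_pow₀ (by norm_num)
    linarith
  have hL0 : 0 < L := by linarith
  set b := Real.exp (-((N : ℝ) / (8 * (4 * k - 1)))) + ((N : ℝ) / (2 * k)) ^ (1 - lam) with hb
  have hb0 : 0 ≤ b := by positivity
  have hsub : Uncovered B s c N ⊆
      ((⋃ v ∈ (Finset.univ : Finset (Sym n)), {ω | ¬ Linked ω.2 {i | Interested B (ω.1 i) v}}) ∪
      (⋃ j ∈ (Finset.univ : Finset (Fin (2 ^ (n + 1)))),
        {ω : (Fin N → Choice n k c) × SimpleGraph (Fin N) |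
          ω.1 ∈ {q : Fin N → Choice n k c | ∀ i, ¬ Hit (q i) j}})) ∪
      {ω : (Fin N → Choice n k c) × SimpleGraph (Fin N) |
        ω.1 ∈ {q : Fin N → Choice n k c | ∀ i, (q i).1 ≠ s}} := by
    rintro ω (hω | hω)
    · left
      by_contra hno
      simp only [Set.mem_union, Set.mem_iUnion, Finset.mem_univ, Set.mem_ofPred_eq, exists_prop,
        true_and, not_or, not_exists, not_not, not_forall] at hno
      refine hω ⟨hno.1, fun v => ?_⟩
      obtain ⟨j, hj⟩ := exists_hit_imp_desired v
      obtain ⟨i, hi⟩ := hno.2 j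
      exact ⟨i, hj _ _ _ hi⟩
    · exact Or.inr hω
  have h1 : μ.real (⋃ v ∈ (Finset.univ : Finset (Sym n)),
      {ω | ¬ Linked ω.2 {i | Interested B (ω.1 i) v}}) ≤ 4 * L * b := by
    refine (measureReal_biUnion_finset_le _ _).trans ((Finset.sum_le_sum fun v _ =>
      law_real_not_linked_le hk hc B p hA hw hp v).trans ?_)
    rw [Finset.sum_const, nsmul_eq_mul]
    refine mul_le_mul_of_nonneg_right ?_ hb0
    rw [hL]
    exact_mod_cast card_sym_le
  have hexpL : Real.exp (-((N : ℝ) / k)) ≤ L⁻¹ * Real.exp (-lam) := by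
    calc Real.exp (-((N : ℝ) / k)) ≤ Real.exp (-Real.log L + -lam) :=
          Real.exp_le_exp.2 (by linarith)
      _ = _ := by rw [Real.exp_add, Real.exp_neg, Real.exp_log hL0]
  have hel : Real.exp (-lam) ≤ 1 := Real.exp_le_one_iff.2 (by linarith)
  have hel0 := Real.exp_pos (-lam)
  -- Each of the `L` leaves is missed with probability at most `L⁻² exp (-2 lam)`.
  have h2 : μ.real (⋃ j ∈ (Finset.univ : Finset (Fin (2 ^ (n + 1)))),
      {ω : (Fin N → Choice n k c) × SimpleGraph (Fin N) |
        ω.1 ∈ {q : Fin N → Choice n k c | ∀ i, ¬ Hit (q i) j}}) ≤ L⁻¹ * Real.exp (-lam) := by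
    refine (measureReal_biUnion_finset_le _ _).trans ((Finset.sum_le_sum fun j _ =>
      (law_real_fst_le p _).trans (uniformOn_real_forall_not_hit_le hk hc j)).trans ?_)
    rw [Finset.sum_const, nsmul_eq_mul, Finset.card_univ, Fintype.card_fin]
    push_cast
    rw [← hL]
    have h3 : Real.exp (-(2 * ((N : ℝ) / k))) = Real.exp (-((N : ℝ) / k)) ^ 2 := by
      rw [← Real.exp_nat_mul]; congr 1; push_cast; ring
    rw [h3]
    calc L * Real.exp (-((N : ℝ) / k)) ^ 2 ≤ L * (L⁻¹ * Real.exp (-lam)) ^ 2 := by gcongr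
      _ = L⁻¹ * (Real.exp (-lam) * Real.exp (-lam)) := by field_simp
      _ ≤ L⁻¹ * (Real.exp (-lam) * 1) := by gcongr
      _ = _ := by rw [mul_one]
  have h3 : μ.real {ω : (Fin N → Choice n k c) × SimpleGraph (Fin N) |
      ω.1 ∈ {q : Fin N → Choice n k c | ∀ i, (q i).1 ≠ s}} ≤ L⁻¹ * Real.exp (-lam) :=
    (law_real_fst_le p _).trans ((uniformOn_real_forall_fst_ne_le hk s).trans hexpL)
  have h4 : L⁻¹ * Real.exp (-lam) ≤ 1 / 2 * Real.exp (-lam) := by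
    gcongr
    rw [one_div]; exact inv_anti₀ (by norm_num) hL2
  calc μ.real (Uncovered B s c N) ≤ _ := measureReal_mono hsub (measure_ne_top _ _)
    _ ≤ (4 * L * b + L⁻¹ * Real.exp (-lam)) + L⁻¹ * Real.exp (-lam) :=
        (measureReal_union_le _ _).trans
          (add_le_add ((measureReal_union_le _ _).trans (add_le_add h1 h2)) h3)
    _ ≤ _ := by linarith

end

/-- If the failure bound is less than one, then `lam > 1` and `N / (8 k) > 6`, and the connectivity
exceeds the threshold of the connectedness of a random graph on `N / (2 k)` nodes. -/
lemma nontrivial_regime (hk : 1 ≤ k) {L lam p α r : ℝ} {M : ℕ} (hL : 2 ≤ L) (hlam : 0 < lam)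
    (hN : k * (Real.log L + lam) ≤ N) (hα : α = M / (N + M)) (hr : r = min (Real.log L) 4)
    (hp : 8 * lam * k * (1 / (1 - α)) * (Real.log (N * r / (8 * k)) / r) ≤ p * (N + M))
    (hlt : Real.exp (-lam) + 4 * L * ((N : ℝ) / (8 * k)) ^ (1 - lam) +
      4 * L * Real.exp (-((N : ℝ) / (8 * (4 * k - 1)))) < 1) :
    24 ≤ (N : ℝ) / (2 * k) ∧ ((N : ℝ) / (2 * k)) ^ (1 - lam) ≤ 1 / 8 ∧
      lam * Real.log ((N : ℝ) / (2 * k)) ≤ p * ((N : ℝ) / (2 * k)) ∧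
      ((N : ℝ) / (2 * k)) ^ (1 - lam) ≤ ((N : ℝ) / (8 * k)) ^ (1 - lam) := by
  have hk1 : (1 : ℝ) ≤ k := by exact_mod_cast hk
  have hk0 : (0 : ℝ) < k := by linarith
  have hlog2 : 0.69 < Real.log L := by
    have h1 := Real.log_two_gt_d9
    have h2 := Real.log_le_log (by norm_num) hL
    norm_num at h1 ⊢
    linarith
  have hNpos : (0 : ℝ) < N := lt_of_lt_of_le (mul_pos hk0 (by norm_num at hlog2; linarith)) hN
  set B : ℝ := (N : ℝ) / (8 * k) with hB
  have hB0 : 0 < B := by positivity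
  have h8B : Real.log L + lam ≤ 8 * B := by
    have : 8 * B = N / k := by rw [hB]; field_simp
    rw [this, le_div_iff₀ hk0]; linarith
  have hA4 : (N : ℝ) / (2 * k) = 4 * B := by rw [hB]; field_simp; norm_num
  have ht0 : 0 < B ^ (1 - lam) := Real.rpow_pos_of_pos hB0 _
  have hX0 := Real.exp_pos (-((N : ℝ) / (8 * (4 * k - 1))))
  have hel0 := Real.exp_pos (-lam)
  have ht8 : B ^ (1 - lam) ≤ 1 / 8 := by nlinarith
  have hX8 : Real.exp (-((N : ℝ) / (8 * (4 * k - 1)))) ≤ 1 / 8 := by nlinarith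
  have hlam1 : 1 < lam := by
    -- For `lam ≤ 1` the bound is at least `(1 - lam) + 8 min 1 B ≥ 1`, since `8 B ≥ log L + lam`.
    by_contra hle
    push Not at hle
    rcases le_total 1 B with h1 | h1
    · have := Real.one_le_rpow h1 (sub_nonneg.2 hle)
      linarith
    · have h2 : B ^ (1 : ℝ) ≤ B ^ (1 - lam) :=
        Real.rpow_le_rpow_of_exponent_ge hB0 h1 (by linarith)
      rw [Real.rpow_one] at h2
      have h3 := Real.add_one_le_exp (-lam)
      norm_num at hlog2
      nlinarith
  have hB6 : 6 ≤ B := by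
    have h1 : 2 ≤ (N : ℝ) / (8 * (4 * k - 1)) := by
      by_contra hlt'
      push Not at hlt'
      have h2 : Real.exp (-2) ≤ 1 / 8 := (Real.exp_le_exp.2 (by linarith)).trans hX8
      have h3 : Real.exp 2 < 8 := by
        have h4 : Real.exp 2 = Real.exp 1 ^ 2 := by rw [← Real.exp_nat_mul]; norm_num
        have h5 : Real.exp 1 ≤ 2.8 := by
          have := Real.exp_one_lt_d9
          norm_num at this ⊢
          linarith
        rw [h4]
        calc Real.exp 1 ^ 2 ≤ 2.8 ^ 2 := by gcongr
          _ < 8 := by norm_num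
      rw [Real.exp_neg, inv_le_comm₀ (Real.exp_pos 2) (by norm_num)] at h2
      norm_num at h2
      linarith
    rw [le_div_iff₀ (by linarith)] at h1
    rw [hB, le_div_iff₀ (by positivity)]
    linarith
  have hr0 : 0.69 < r := by rw [hr]; exact lt_min hlog2 (by norm_num)
  have hr4 : r ≤ 4 := by rw [hr]; exact min_le_right _ _
  norm_num at hr0
  have hrpos : 0 < r := by linarith
  have hle : (4 * B) ^ (1 - lam) ≤ B ^ (1 - lam) :=
    Real.rpow_le_rpow_of_nonpos hB0 (by linarith) (by linarith)
  rw [hA4]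
  refine ⟨by linarith, hle.trans ht8, ?_, hle⟩
  -- `log x / x` decreases for `x ≥ e`, and `e ≤ r B ≤ 4 B`.
  have hNM : (0 : ℝ) < N + M := by positivity
  have h1α : 1 / (1 - α) = (N + M) / N := by
    have h2 : 1 - α = N / (N + M) := by rw [hα, eq_div_iff hNM.ne']; field_simp; ring
    rw [h2, one_div_div]
  have hNr : (N : ℝ) * r / (8 * k) = B * r := by rw [hB]; ring
  have hkB : (k : ℝ) = N / (8 * B) := by rw [hB]; field_simp
  have hBr : lam * (Real.log (B * r) / (B * r)) ≤ p := by
    rw [h1α, hNr] at hp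
    have h2 : 8 * lam * k * ((N + M) / N) * (Real.log (B * r) / r) =
        lam * (Real.log (B * r) / (B * r)) * (N + M) := by
      have h3 : (8 : ℝ) * k / N = 1 / B := by rw [hB]; field_simp
      calc 8 * lam * k * ((N + M) / N) * (Real.log (B * r) / r)
          = (8 * k / N) * (lam * (Real.log (B * r) / r) * (N + M)) := by ring
        _ = _ := by rw [h3]; field_simp
    rw [h2] at hp
    exact le_of_mul_le_mul_right hp hNM
  have he : Real.exp 1 ≤ B * r := by
    have := Real.exp_one_lt_d9
    norm_num at this
    nlinarith
  have hanti := Real.log_div_self_antitoneOn (a := B * r) (b := 4 * B) he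
    (by show Real.exp 1 ≤ 4 * B; nlinarith) (by nlinarith)
  have h5 : lam * (Real.log (4 * B) / (4 * B)) ≤ p :=
    (mul_le_mul_of_nonneg_left hanti hlam.le).trans hBr
  calc lam * Real.log (4 * B) = lam * (Real.log (4 * B) / (4 * B)) * (4 * B) := by field_simp
    _ ≤ p * (4 * B) := by gcongr

lemma pos_of_div_le (hk : 1 ≤ k) (hc : (2 : ℝ) ^ (n + 1) / k ≤ c) : 0 < c := by
  have hk0 : (0 : ℝ) < k := by exact_mod_cast hk
  have : (0 : ℝ) < c := lt_of_lt_of_le (by positivity) hc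
  exact_mod_cast this

section
variable {F H A Sg : Type*} {C : Scheme n k F H A Sg}

/-- Each sample of a node hits the siblings of a stopping set with probability at least `f`. -/
lemma law_real_exists_not_desired_le (hk : 1 ≤ k) {f z : ℝ} (hf : f ∈ Set.Icc (0 : ℝ) 1)
    (hz : 0 ≤ z) (hc : z ≤ c) (p : unitInterval) (ℓ : Fin (n + 1)) (T : Finset (Pos ℓ))
    (hT : f * Fintype.card (Pos ℓ) ≤ T.card) :
    (law n k c N p).real {ω | ∃ i, ∀ d ∈ T, ¬ Desired (ω.1 i) (some ⟨ℓ, d⟩)} ≤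
      N * (1 - f) ^ z := by
  classical
  have : NeZero k := ⟨by omega⟩
  obtain ⟨B, hB, hdes⟩ := exists_card_mul_le ℓ T
  set D : Finset (Choice n k c) := Finset.univ.filter fun q => ∀ t, q.2 t ∉ B with hD
  have hPn : (0 : ℝ) < Fintype.card (Pos n) := by exact_mod_cast Fintype.card_pos
  have hPℓ : (0 : ℝ) < Fintype.card (Pos ℓ) := by exact_mod_cast Fintype.card_pos
  have hfB : f ≤ B.card / Fintype.card (Pos n) := by
    rw [le_div_iff₀ hPn]
    have hB' : (T.card : ℝ) * Fintype.card (Pos n) ≤ B.card * Fintype.card (Pos ℓ) := by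
      exact_mod_cast hB
    refine le_of_mul_le_mul_right ?_ hPℓ
    calc f * Fintype.card (Pos n) * Fintype.card (Pos ℓ)
        = f * Fintype.card (Pos ℓ) * Fintype.card (Pos n) := by ring
      _ ≤ T.card * Fintype.card (Pos n) := by gcongr
      _ ≤ _ := hB'
  have hB1 : (B.card : ℝ) / Fintype.card (Pos n) ≤ 1 := by
    rw [div_le_one hPn]; exact_mod_cast Finset.card_le_univ B
  have hone : ∀ i : Fin N, (law n k c N p).real
      {ω : (Fin N → Choice n k c) × SimpleGraph (Fin N) | ω.1 ∈ {q | q i ∈ D}} ≤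
        (1 - f) ^ z := by
    intro i
    refine (law_real_fst_le p _).trans ?_
    rw [uniformOn_real_eval_mem, hD, card_choice_forall_notMem hk]
    calc (1 - (B.card : ℝ) / Fintype.card (Pos n)) ^ c ≤ (1 - f) ^ c :=
          pow_le_pow_left₀ (by linarith) (by linarith) _
      _ = (1 - f) ^ (c : ℝ) := (Real.rpow_natCast _ _).symm
      _ ≤ (1 - f) ^ z :=
          Real.rpow_le_rpow_of_exponent_ge' (by linarith [hf.2]) (by linarith [hf.1]) hz hc
  have hsub : {ω : (Fin N → Choice n k c) × SimpleGraph (Fin N) |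
      ∃ i, ∀ d ∈ T, ¬ Desired (ω.1 i) (some ⟨ℓ, d⟩)} ⊆
      ⋃ i ∈ (Finset.univ : Finset (Fin N)), {ω | ω.1 ∈ {q | q i ∈ D}} := by
    rintro ω ⟨i, hi⟩
    simp only [Set.mem_iUnion, Finset.mem_univ, exists_prop, true_and, Set.mem_ofPred_eq]
    refine ⟨i, Finset.mem_filter.2 ⟨Finset.mem_univ _, fun t ht => ?_⟩⟩
    obtain ⟨d, hd, hdd⟩ := hdes k c (ω.1 i) t ht
    exact hi d hd hdd
  refine (measureReal_mono hsub (measure_ne_top _ _)).trans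
    ((measureReal_biUnion_finset_le _ _).trans ((Finset.sum_le_sum fun i _ => hone i).trans ?_))
  simp

variable [AddCommGroup F]

lemma le_law_real_forall_rejects_of_not_available (hk : 1 ≤ k) {f z : ℝ}
    (hf : f ∈ Set.Icc (0 : ℝ) 1) (hc0 : 0 < c) (hz : 0 ≤ z) (hc : z ≤ c) (p : unitInterval)
    (hcode : ∀ ℓ : Fin (n + 1), ∀ T : Finset (Pos ℓ), IsStoppingSet (C.code ℓ) T →
      f * Fintype.card (Pos ℓ) ≤ T.card)
    (chain : ℕ → Block C) (g : ℕ) {R : Set (Sym n)}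
    (adv : (Fin N → Choice n k c) × SimpleGraph (Fin N) → Fin N → Msg n F H A Sg → Prop)
    (hav : ¬ Available C R) (hH : ∀ ω, Hides chain g R (adv ω)) :
    1 - N * (1 - f) ^ z ≤
      (law n k c N p).real {ω | ∀ i, Rejects chain g ω.2 ω.1 (adv ω) i} := by
  classical
  have : NeZero k := ⟨by omega⟩
  by_cases hroot : none ∈ R
  · obtain ⟨ℓ, a, ha⟩ : ∃ ℓ, ∃ a, ¬ Peeled (C.code ℓ) {b | some ⟨ℓ, b⟩ ∈ R} a := by
      by_contra hno
      push Not at hno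
      exact hav ⟨hroot, hno⟩
    refine one_sub_le_measureReal_of_compl_subset _ ?_ (law_real_exists_not_desired_le hk hf hz hc p
      ℓ _ (hcode ℓ _ (isStoppingSet_not_peeled ha)))
    intro ω hω i
    simp only [Set.mem_compl_iff, Set.mem_ofPred_eq, not_exists, not_forall, not_not] at hω
    obtain ⟨d, hd, hdes⟩ := hω i
    exact rejects_of_desired_not_peeled (hH ω) (Finset.mem_filter.1 hd).2 hdes
  · have h1 : {ω | ∀ i, Rejects chain g ω.2 ω.1 (adv ω) i} = Set.univ :=
      Set.eq_univ_of_forall fun ω i => rejects_of_none_notMem hc0 (hH ω) hroot i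
    rw [h1, probReal_univ]
    have h2 : 0 ≤ (N : ℝ) * (1 - f) ^ z :=
      mul_nonneg (by positivity) (Real.rpow_nonneg (by linarith [hf.2]) _)
    linarith

end

/-- An event that contains the complement of `Uncovered B s c N` has the probability claimed for the
acceptance of valid and the rejection of invalid blocks. -/
lemma le_law_real_of_compl_uncovered_subset {M : ℕ} {F H A Sg : Type*}
    {C : Scheme n k F H A Sg} (hk : 1 ≤ k) (hc : (2 : ℝ) ^ (n + 1) / k ≤ c) (B : Block C)
    (s : Fin k) (p : unitInterval) {L lam α r : ℝ} (hL : L = 2 ^ (n + 1)) (hlam : 0 < lam)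
    (hN : k * (Real.log L + lam) ≤ N) (hα : α = M / (N + M)) (hr : r = min (Real.log L) 4)
    (hp : 8 * lam * k * (1 / (1 - α)) * (Real.log (N * r / (8 * k)) / r) ≤ (p : ℝ) * (N + M))
    {S : Set ((Fin N → Choice n k c) × SimpleGraph (Fin N))} (hS : (Uncovered B s c N)ᶜ ⊆ S) :
    1 - Real.exp (-lam) - 4 * L * ((N : ℝ) / (8 * k)) ^ (1 - lam)
        - 4 * L * Real.exp (-((N : ℝ) / (8 * (4 * k - 1)))) ≤ (law n k c N p).real S := by
  have : NeZero k := ⟨by omega⟩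
  have hk0 : (0 : ℝ) < k := by exact_mod_cast hk
  rcases lt_or_ge (Real.exp (-lam) + 4 * L * ((N : ℝ) / (8 * k)) ^ (1 - lam) +
      4 * L * Real.exp (-((N : ℝ) / (8 * (4 * k - 1))))) 1 with hlt | hge
  · have hL2 : 2 ≤ L := by
      rw [hL, pow_succ]
      have : (1 : ℝ) ≤ 2 ^ n := one_le_pow₀ (by norm_num)
      linarith
    obtain ⟨hA, hw, hpA, hle⟩ := nontrivial_regime hk hL2 hlam hN hα hr hp hlt
    have h1 := one_sub_le_measureReal_of_compl_subset (law n k c N p) hS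
      (law_real_uncovered_le hk hc B s p hlam hA hw hpA
        (by rw [← hL, le_div_iff₀ hk0]; linarith))
    rw [← hL] at h1
    have h2 : 4 * L * ((N : ℝ) / (2 * k)) ^ (1 - lam) ≤
        4 * L * ((N : ℝ) / (8 * k)) ^ (1 - lam) := by gcongr
    linarith
  · have h1 : 0 ≤ (law n k c N p).real S := measureReal_nonneg
    linarith

end CoVer

theorem theorem1 {F H A Sg : Type*} [AddCommGroup F]
    -- blocks have `2 ^ (n + 1)` transactions; `k` sections; `N` honest and `M` dishonest nodes
    (n k N M : ℕ) (hk : 1 ≤ k) (C : CoVer.Scheme n k F H A Sg)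
    (L : ℕ) (hL : L = 2 ^ (n + 1))
    (lam : ℝ) (hlam : 0 < lam) (hN : k * (Real.log L + lam) ≤ N)
    -- the connectivity: `p * (N + M)` neighbours per node, `α` the fraction of dishonest nodes, and
    -- `r / (4 * k)` the fraction of the nodes that a symbol is taken to be downloaded by
    (α : ℝ) (hα : α = M / (N + M)) (p : unitInterval) (r : ℝ) (hr : r = min (Real.log L) 4)
    (hp : 8 * lam * k * (1 / (1 - α)) * (Real.log (N * r / (8 * k)) / r) ≤ (p : ℝ) * (N + M))
    -- `f` is a lower bound for the relative size of the stopping sets of all layers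
    (f : ℝ) (hf : f ∈ Set.Icc (0 : ℝ) 1)
    (hcode : ∀ ℓ : Fin (n + 1), ∀ T : Finset (CoVer.Pos ℓ), CoVer.IsStoppingSet (C.code ℓ) T →
      f * Fintype.card (CoVer.Pos ℓ) ≤ T.card)
    -- the block at height `g` is to be verified; the transactions in earlier blocks are valid
    (chain : ℕ → CoVer.Block C) (g : ℕ)
    (hpast : ∀ g' < g, ∀ j, CoVer.TxValid chain g' ((chain g').tx j))
    -- the released symbols of the block
    (R : Set (CoVer.Sym n))
    -- the behaviour of the adversary, who sees all random choices
    (adv : (Fin N → CoVer.Choice n k (CoVer.numSamples n k)) × SimpleGraph (Fin N) →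
      Fin N → CoVer.Msg n F H A Sg → Prop) :
    (CoVer.BlockValid chain g → CoVer.Available C R →
      (∀ ω, CoVer.Releases chain g ω.1 R (adv ω)) →
      1 - Real.exp (-lam) - 4 * L * ((N : ℝ) / (8 * k)) ^ (1 - lam)
          - 4 * L * Real.exp (-((N : ℝ) / (8 * (4 * k - 1)))) ≤
        (CoVer.law n k (CoVer.numSamples n k) N p).real
          {ω | ∀ i, CoVer.Accepts chain g ω.2 ω.1 (adv ω) i}) ∧
    (¬ CoVer.Available C R →
      (∀ ω, CoVer.Hides chain g R (adv ω)) →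
      1 - N * (1 - f) ^ ((L : ℝ) / k) ≤
        (CoVer.law n k (CoVer.numSamples n k) N p).real
          {ω | ∀ i, CoVer.Rejects chain g ω.2 ω.1 (adv ω) i}) ∧
    (¬ CoVer.BlockValid chain g → CoVer.Available C R →
      (∀ ω, CoVer.Releases chain g ω.1 R (adv ω)) →
      1 - Real.exp (-lam) - 4 * L * ((N : ℝ) / (8 * k)) ^ (1 - lam)
          - 4 * L * Real.exp (-((N : ℝ) / (8 * (4 * k - 1)))) ≤
        (CoVer.law n k (CoVer.numSamples n k) N p).real
          {ω | ∀ i, CoVer.Rejects chain g ω.2 ω.1 (adv ω) i}) := by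
  have hk0 : (0 : ℝ) < k := by exact_mod_cast hk
  have hLR : (L : ℝ) = 2 ^ (n + 1) := by rw [hL]; push_cast; rfl
  have hc : (2 : ℝ) ^ (n + 1) / k ≤ CoVer.numSamples n k := Nat.le_ceil _
  have hc0 := CoVer.pos_of_div_le hk hc
  refine ⟨fun hB hav hR => ?_, fun hav hH => ?_, fun hB hav hR => ?_⟩
  · refine CoVer.le_law_real_of_compl_uncovered_subset hk hc (chain g) ⟨0, hk⟩ p hLR hlam hN hα hr hp
      fun ω hω i => ?_
    simp only [CoVer.Uncovered, Set.mem_compl_iff, Set.mem_ofPred_eq, not_or, not_not] at hω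
    exact hω.1.accepts hB hav (hR ω) i
  · exact CoVer.le_law_real_forall_rejects_of_not_available hk hf hc0 (by positivity)
      (by rw [hLR]; exact hc) p hcode chain g adv hav hH
  · by_cases hcv : CoVer.CodeValid (chain g)
    · obtain ⟨j, hj⟩ : ∃ j, ¬ CoVer.TxValid chain g ((chain g).tx j) := by
        by_contra hno
        push Not at hno
        exact hB ⟨hno, hcv⟩
      refine CoVer.le_law_real_of_compl_uncovered_subset hk hc (chain g)
        (C.sect ((chain g).tx j).sender) p hLR hlam hN hα hr hp fun ω hω i => ?_
      simp only [CoVer.Uncovered, Set.mem_compl_iff, Set.mem_ofPred_eq, not_or, not_not,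
        not_forall] at hω
      obtain ⟨hcov, i', hi'⟩ := hω
      exact hcov.rejects_of_not_txValid hc0 hpast hj hi'.symm hav (hR ω) i
    · refine CoVer.le_law_real_of_compl_uncovered_subset hk hc (chain g) ⟨0, hk⟩ p hLR hlam hN hα hr
        hp fun ω hω i => ?_
      simp only [CoVer.Uncovered, Set.mem_compl_iff, Set.mem_ofPred_eq, not_or, not_not] at hω
      exact hω.1.rejects_of_not_codeValid hc0 hcv hav (hR ω) i
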